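/- Manifolds are finite-dimensional, Hausdorff, paracompact and smooth, not necessarily connected; ranks of vector bundles and dimensions of submanifolds are only locally constant. Let $\mathbb R_+=\{t\in\mathbb R: t\ge 0\}$. A homogeneous structure on a manifold $F$ is an action $h:\mathbb R_+\times F\to F$, $h_1=\mathrm{id}$, $h_t\circ h_s=h_{ts}$, of the multiplicative monoid $(\mathbb R_+,\cdot)$ which is smooth (it extends to a smooth map $U\times F\to F$ for some open neighbourhood $U$ of $\mathbb R_+$ in $\mathbb R$), and whose vertical lift $$\mathcal V_h:F\to TF,\qquad \mathcal V_h(x)=\tfrac{d}{dt}\Big|_{t=0^+}h_t(x)\in T_{h_0(x)}F,$$ vanishes only at points $x\in N:=h_0(F)$. Theorem 2.1. Let $h$ be a homogeneous structure on a manifold $F$. Then there is a unique smooth real vector bundle structure on $F$ (a vector bundle with total space $F$, its base being identified with the image of the zero section) whose homotheties by $t\in\mathbb R_+$ are the maps $h_t$. Moreover, $N=h_0(F)$ is an embedded submanifold of $F$; the set $E=\{v\in T_xF: x\in N,\ (d h_0)_x v=0\}$ is a smooth vector subbundle of $TF|_N$ over $N$; and $\mathcal V_h$ is a smooth embedding of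 $F$ into $TF$ with image $E$, so that $F$ is diffeomorphic to $E$. The vector bundle structure has base $N$ and projection $h_0$, and $\mathcal V_h$ is linear on its fibres. -/

import Mathlib

open Set Topology
open scoped Manifold ContDiff NNReal

noncomputable section

/-- `Φ` is a smooth chart of the manifold `M` with values in an open subset of `ℝ^m × ℝ^k`. -/
structure IsSmoothProductChart {E H M : Type*} [NormedAddCommGroup E] [NormedSpace ℝ E]
    [TopologicalSpace H] (I : ModelWithCorners ℝ E H) [TopologicalSpace M] [ChartedSpace H M]
    {m k : ℕ}
    (Φ : OpenPartialHomeomorph M (EuclideanSpace ℝ (Fin m) × EuclideanSpace ℝ (Fin k))) :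
    Prop where
  contMDiffOn :
    ContMDiffOn I 𝓘(ℝ, EuclideanSpace ℝ (Fin m) × EuclideanSpace ℝ (Fin k)) ∞ Φ Φ.source
  contMDiffOn_symm :
    ContMDiffOn 𝓘(ℝ, EuclideanSpace ℝ (Fin m) × EuclideanSpace ℝ (Fin k)) I ∞ Φ.symm Φ.target

/-- `S` is an embedded submanifold of `M`: around each of its points there is a chart
`Φ : U → ℝ^m × ℝ^k` of `M` in which `S ∩ U` is the slice `{(x, y) | y = 0}`.  The dimension `m` may
vary with the connected component. -/
def IsEmbeddedSubmanifold {E H M : Type*} [NormedAddCommGroup E] [NormedSpace ℝ E]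
    [TopologicalSpace H] (I : ModelWithCorners ℝ E H) [TopologicalSpace M] [ChartedSpace H M]
    (S : Set M) : Prop :=
  ∀ p ∈ S, ∃ (m k : ℕ)
    (Φ : OpenPartialHomeomorph M (EuclideanSpace ℝ (Fin m) × EuclideanSpace ℝ (Fin k))),
    p ∈ Φ.source ∧ IsSmoothProductChart I Φ ∧ ∀ x ∈ Φ.source, x ∈ S ↔ (Φ x).2 = 0

/-- A smooth real vector bundle structure (of finite, locally constant rank) on the manifold `F`,
that is, a vector bundle with total space `F`.

The base is identified with the image of the zero section, hence is a subset of `F`; the bundle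
projection then is a retraction onto it, and `b` is the zero vector of the fibre over `b`.
Local triviality: over a neighbourhood of each point of the base there is a chart `Φ = (x, y)` of
the manifold `F`, defined on a full preimage under the projection, with image `W × ℝ^k`, such that
`x` is (the pull-back of) a coordinate system of the base and `y` is linear on the fibres.  In
particular the base is the slice `{y = 0}`, a submanifold of `F`, and each fibre in the domain of
`Φ` is mapped by `y` isomorphically onto `ℝ^k`. -/
structure VectorBundleStructure (n : ℕ) (F : Type*) [TopologicalSpace F]
    [ChartedSpace (EuclideanSpace ℝ (Fin n)) F] where
  /-- the base, as the zero section -/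
  base : Set F
  /-- the bundle projection -/
  proj : F → base
  /-- the addition in the fibres -/
  [fibreAddCommGroup : ∀ b : base, AddCommGroup {x : F // proj x = b}]
  /-- the multiplication by reals in the fibres -/
  [fibreModule : ∀ b : base, Module ℝ {x : F // proj x = b}]
  coe_zero : ∀ b : base, ((0 : {x : F // proj x = b}) : F) = b
  locallyTrivial : ∀ b : base, ∃ (m k : ℕ) (W : Set (EuclideanSpace ℝ (Fin m)))
    (Φ : OpenPartialHomeomorph F (EuclideanSpace ℝ (Fin m) × EuclideanSpace ℝ (Fin k))),
    (b : F) ∈ Φ.source ∧ IsSmoothProductChart (𝓡 n) Φ ∧ Φ.target = W ×ˢ univ ∧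
    (∀ x : F, x ∈ Φ.source ↔ (proj x : F) ∈ Φ.source) ∧
    (∀ x ∈ Φ.source, ∀ y ∈ Φ.source, (Φ x).1 = (Φ y).1 ↔ proj x = proj y) ∧
    (∀ c : base, (c : F) ∈ Φ.source →
      IsLinearMap ℝ fun u : {x : F // proj x = c} => (Φ (u : F)).2)

namespace VectorBundleStructure

variable {n : ℕ} {F : Type*} [TopologicalSpace F] [ChartedSpace (EuclideanSpace ℝ (Fin n)) F]

attribute [instance] VectorBundleStructure.fibreAddCommGroup VectorBundleStructure.fibreModule

/-- The fibre over the point `b` of the base. -/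
abbrev Fibre (S : VectorBundleStructure n F) (b : S.base) : Type _ := {x : F // S.proj x = b}

/-- The homothety `x ↦ t • x`, computed in the fibre containing `x`. -/
def homothety (S : VectorBundleStructure n F) (t : ℝ) (x : F) : F :=
  ((t • (⟨x, rfl⟩ : S.Fibre (S.proj x)) : S.Fibre (S.proj x)) : F)

end VectorBundleStructure

/-- The vertical lift: `verticalLift n h x` is the vector tangent at `t = 0` to the curve
`ℝ₊ ∋ t ↦ h t x`, an element of the tangent space of `F` at `h 0 x`. -/
def verticalLift (n : ℕ) {F : Type*} [TopologicalSpace F]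
    [ChartedSpace (EuclideanSpace ℝ (Fin n)) F] [IsManifold (𝓡 n) ∞ F]
    (h : ℝ≥0 → F → F) (x : F) : TangentBundle (𝓡 n) F :=
  tangentMapWithin 𝓘(ℝ, ℝ) (𝓡 n) (fun t : ℝ => h t.toNNReal x) (Ici 0)
    ⟨0, (1 : ℝ)⟩

/-- A homogeneous structure on the manifold `F`: a smooth action `h` of the multiplicative monoid of
non-negative reals whose vertical lift vanishes only at the points of `h₀(F)`.  Smoothness means
that `h` is the restriction of a smooth map on `U × F` for some neighbourhood `U` of `ℝ₊`
in `ℝ`. -/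
structure IsHomogeneousStructure (n : ℕ) {F : Type*} [TopologicalSpace F]
    [ChartedSpace (EuclideanSpace ℝ (Fin n)) F] [IsManifold (𝓡 n) ∞ F]
    (h : ℝ≥0 → F → F) : Prop where
  one_act : ∀ x, h 1 x = x
  mul_act : ∀ t s x, h (t * s) x = h t (h s x)
  smooth : ∃ (U : Set ℝ) (H : ℝ × F → F), IsOpen U ∧ Ici 0 ⊆ U ∧
    ContMDiffOn (𝓘(ℝ, ℝ).prod (𝓡 n)) (𝓡 n) ∞ H (U ×ˢ univ) ∧
    ∀ (t : ℝ≥0) (x : F), H ((t : ℝ), x) = h t x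
  nonsingular : ∀ x, (verticalLift n h x).2 = 0 → x ∈ range (h 0)

/-- `D` is (the total space of) a vector subbundle of `TF` over the submanifold `N` of `F`: it
consists of vectors at points of `N`, and near each point of `N` there are smooth local vector
fields on `F` which, at each point of `N`, form a basis of the fibre of `D`.  The rank may vary
with the connected component of `N`. -/
structure IsTangentSubbundleOver (n : ℕ) {F : Type*} [TopologicalSpace F]
    [ChartedSpace (EuclideanSpace ℝ (Fin n)) F] [IsManifold (𝓡 n) ∞ F]
    (N : Set F) (D : Set (TangentBundle (𝓡 n) F)) : Prop where
  isEmbeddedSubmanifold : IsEmbeddedSubmanifold (𝓡 n) N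
  proj_mem : ∀ v ∈ D, v.1 ∈ N
  exists_frame : ∀ p ∈ N, ∃ (U : Set F) (k : ℕ) (s : Fin k → ∀ q : F, TangentSpace (𝓡 n) q),
    IsOpen U ∧ p ∈ U ∧
    (∀ i, ContMDiffOn (𝓡 n) (𝓡 n).tangent ∞
      (fun q => (⟨q, s i q⟩ : TangentBundle (𝓡 n) F)) U) ∧
    ∀ q ∈ U ∩ N, LinearIndependent ℝ (fun i => s i q) ∧
      ∀ v : TangentSpace (𝓡 n) q,
        (⟨q, v⟩ : TangentBundle (𝓡 n) F) ∈ D ↔ v ∈ Submodule.span ℝ (range fun i => s i q)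

/-- The part over `h₀(F)` of the vertical subbundle: the vectors tangent to `F` at points of
`h₀(F)` which are annihilated by the derivative of the projection `h₀`. -/
def verticalVectors (n : ℕ) {F : Type*} [TopologicalSpace F]
    [ChartedSpace (EuclideanSpace ℝ (Fin n)) F] [IsManifold (𝓡 n) ∞ F]
    (h : ℝ≥0 → F → F) : Set (TangentBundle (𝓡 n) F) :=
  {v | v.1 ∈ range (h 0) ∧ mfderiv (𝓡 n) (𝓡 n) (h 0) v.1 v.2 = 0}

end

/-! The action can be linearized around `N = h₀(F)`, and the vertical lift `V` supplies a canonical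
linear coordinate on the fibres of `h₀`.

In a chart around a point of `N`, let `P` and `C` be the derivatives there of `h₀` and of `V`. The
identities `h₀ ∘ h₀ = h₀`, `V ∘ h₀ = 0`, `h₀ ∘ h_t = h₀` and `V ∘ h_t = t V`, the last two
differentiated along orbits, give `P² = P`, `CP = 0`, `PC = 0`, `C² = C`. If `1 - P - C` were
nonzero, moving slightly in a direction of its image would produce a point outside `N` with zero
vertical lift; so `C = 1 - P` (`fderiv_retraction_and_vertical`).

Hence `P ∘ h₀ + (1 - P) ∘ V` is a chart in which `h_t` is `z ↦ Pz + t (z - Pz)`. As `h_t` is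
invertible for `t > 0` and pushes points towards `N` as `t → 0`, the chart extends to a full
preimage under `h₀` (`exists_homogeneousChart`). There `V` becomes the linear map `z ↦ (Pz, z -
Pz)`, from which the claims on `N`, `E` and the embedding follow.

Each fibre of `h₀` receives through `V` the linear structure of the vertical vectors
(`vectorBundleStructure`). In any bundle with homotheties `h_t` the orbits are rays, so `V` is
linear on fibres; being injective, it determines all operations (`eq_of_homothety`). -/

/-! ### Calculus in a normed space -/

section Calculus

variable {E : Type*} [NormedAddCommGroup E] [NormedSpace ℝ E]

/-- A smooth map whose derivative at a point is the identity restricts to a diffeomorphism between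
open sets. -/
theorem exists_openPartialHomeomorph_of_hasFDerivAt_id [CompleteSpace E] {f : E → E} {D : Set E}
    (hD : IsOpen D) (hf : ContDiffOn ℝ ∞ f D) {z : E} (hz : z ∈ D)
    (hf' : HasFDerivAt f (ContinuousLinearMap.id ℝ E) z) :
    ∃ e : OpenPartialHomeomorph E E, z ∈ e.source ∧ e.source ⊆ D ∧ (e : E → E) = f ∧
      ContDiffOn ℝ ∞ e.symm e.target := by
  have hfz : ContDiffAt ℝ ∞ f z := hf.contDiffAt (hD.mem_nhds hz)
  let e₀ := hfz.toOpenPartialHomeomorph f (f' := ContinuousLinearEquiv.refl ℝ E) hf' (by simp)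
  have he₀ : (e₀ : E → E) = f := rfl
  have hz₀ : z ∈ e₀.source :=
    hfz.mem_toOpenPartialHomeomorph_source (f' := ContinuousLinearEquiv.refl ℝ E) hf' (by simp)
  -- Smoothness of the inverse at a point requires an invertible derivative of `f` there. This is an
  -- open condition, so the local inverse is restricted to it.
  let G : Set E := D ∩ fderiv ℝ f ⁻¹' range ((↑) : (E ≃L[ℝ] E) → E →L[ℝ] E)
  have hG : IsOpen G :=
    (hf.continuousOn_fderiv_of_isOpen hD (by simp)).isOpen_inter_preimage hD
      ContinuousLinearEquiv.isOpen
  have hzG : z ∈ G := ⟨hz, ContinuousLinearEquiv.refl ℝ E, hf'.fderiv.symm⟩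
  refine ⟨e₀.restrOpen G hG, ⟨hz₀, hzG⟩, fun x hx => hx.2.1, he₀, fun y hy => ?_⟩
  have hy' : e₀.symm y ∈ G := by
    have := (e₀.restrOpen G hG).map_target hy
    exact this.2
  have hyt : y ∈ e₀.target := hy.1
  obtain ⟨g, hg⟩ := hy'.2
  have h1 : HasFDerivAt e₀ (g : E →L[ℝ] E) (e₀.symm y) := by
    rw [hg]
    exact ((hf.contDiffAt (hD.mem_nhds hy'.1)).differentiableAt (by simp)).hasFDerivAt
  exact (e₀.contDiffAt_symm hyt h1 (hf.contDiffAt (hD.mem_nhds hy'.1))).contDiffWithinAt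

/-- In the product rule the derivative of `A` is applied to `v z = 0`, so that term drops out. -/
theorem HasFDerivAt.clm_apply_of_eq_zero {A : E → E →L[ℝ] E} {v : E → E} {C : E →L[ℝ] E} {z : E}
    (hA : DifferentiableAt ℝ A z) (hv : HasFDerivAt v C z) (hv0 : v z = 0) :
    HasFDerivAt (fun x => A x (v x)) (A z ∘L C) z := by
  have := hA.hasFDerivAt.clm_apply hv
  convert this using 1
  ext w
  simp [hv0]

/-- Local retractions `r` and vertical fields `v`: the derivatives at a fixed point are
complementary projections. -/
theorem fderiv_retraction_and_vertical [CompleteSpace E] {r v : E → E} {z : E}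
    (hr : ContDiffAt ℝ ∞ r z) (hv : ContDiffAt ℝ ∞ v z) (hrz : r z = z)
    (hrr : ∀ᶠ x in 𝓝 z, r (r x) = r x) (hvr : ∀ᶠ x in 𝓝 z, v (r x) = 0)
    (hrv : ∀ᶠ x in 𝓝 z, fderiv ℝ r (r x) (v x) = 0)
    (hvv : ∀ᶠ x in 𝓝 z, fderiv ℝ v (r x) (v x) = v x)
    (hns : ∀ᶠ x in 𝓝 z, v x = 0 → r x = x) :
    (∀ w, fderiv ℝ r z (fderiv ℝ r z w) = fderiv ℝ r z w) ∧
      ∀ w, fderiv ℝ v z w = w - fderiv ℝ r z w := by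
  have hvz : v z = 0 := by simpa [hrz] using hvr.self_of_nhds
  have hr' : HasFDerivAt r (fderiv ℝ r z) z := (hr.differentiableAt (by simp)).hasFDerivAt
  have hv' : HasFDerivAt v (fderiv ℝ v z) z := (hv.differentiableAt (by simp)).hasFDerivAt
  have hdr : DifferentiableAt ℝ (fun x => fderiv ℝ r (r x)) z := by
    have h1 : ContDiffAt ℝ 1 (fderiv ℝ r) (r z) := by
      rw [hrz]; exact hr.fderiv_right (by norm_cast)
    exact (h1.differentiableAt (by simp)).comp z (hr.differentiableAt (by simp))
  have hdv : DifferentiableAt ℝ (fun x => fderiv ℝ v (r x)) z := by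
    have h1 : ContDiffAt ℝ 1 (fderiv ℝ v) (r z) := by
      rw [hrz]; exact hv.fderiv_right (by norm_cast)
    exact (h1.differentiableAt (by simp)).comp z (hr.differentiableAt (by simp))
  have hP1 := HasFDerivAt.clm_apply_of_eq_zero hdr hv' hvz
  have hC1 := HasFDerivAt.clm_apply_of_eq_zero hdv hv' hvz
  simp only [hrz] at hP1 hC1
  set P := fderiv ℝ r z with hP
  set C := fderiv ℝ v z with hC
  have hPP : P ∘L P = P := by
    have h1 : HasFDerivAt (fun x => r (r x)) (P ∘L P) z := by
      refine HasFDerivAt.comp z ?_ hr'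
      rwa [hrz]
    exact (h1.congr_of_eventuallyEq (hrr.mono fun x hx => hx.symm)).unique hr'
  have hCP : C ∘L P = 0 := by
    have h1 : HasFDerivAt (fun x => v (r x)) (C ∘L P) z := by
      refine HasFDerivAt.comp z ?_ hr'
      rwa [hrz]
    exact (h1.congr_of_eventuallyEq (hvr.mono fun x hx => hx.symm)).unique
      (hasFDerivAt_const (0 : E) z)
  have hPC : P ∘L C = 0 :=
    (hP1.congr_of_eventuallyEq (hrv.mono fun x hx => hx.symm)).unique (hasFDerivAt_const (0 : E) z)
  have hCC : C ∘L C = C :=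
    (hC1.congr_of_eventuallyEq (hvv.mono fun x hx => hx.symm)).unique hv'
  have ePP : ∀ w, P (P w) = P w := fun w => congrArg (fun f : E →L[ℝ] E => f w) hPP
  have eCP : ∀ w, C (P w) = 0 := fun w => congrArg (fun f : E →L[ℝ] E => f w) hCP
  have ePC : ∀ w, P (C w) = 0 := fun w => congrArg (fun f : E →L[ℝ] E => f w) hPC
  have eCC : ∀ w, C (C w) = C w := fun w => congrArg (fun f : E →L[ℝ] E => f w) hCC
  refine ⟨ePP, ?_⟩
  -- The part of the identity not accounted for by `P` and `C`; both annihilate it. Only the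
  -- hypothesis on the zeros of `v` forces it to vanish.
  set Q : E →L[ℝ] E := ContinuousLinearMap.id ℝ E - P - C with hQ
  have eQ : ∀ w, Q w = w - P w - C w := fun w => rfl
  suffices hq : ∀ q, Q q = 0 by
    intro w
    have := hq w
    rw [eQ] at this
    rw [sub_eq_zero] at this
    exact this.symm
  intro q
  -- Chosen so that its derivative at `z` is `PP + CC + Q(1 - P) = P + C + Q`, the identity.
  let θ : E → E := fun x => P (r x) + C (v x) + Q (x - r x)
  have hrs : HasStrictFDerivAt r P z := hr.hasStrictFDerivAt (by simp)
  have hvs : HasStrictFDerivAt v C z := hv.hasStrictFDerivAt (by simp)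
  have hθ : HasStrictFDerivAt θ ((ContinuousLinearEquiv.refl ℝ E : E ≃L[ℝ] E) : E →L[ℝ] E) z := by
    have h1 := ((P.hasStrictFDerivAt.comp z hrs).add (C.hasStrictFDerivAt.comp z hvs)).add
      (Q.hasStrictFDerivAt.comp z ((hasStrictFDerivAt_id z).sub hrs))
    refine h1.congr_fderiv ?_
    ext w
    simp [eQ, ePP, eCC, eCP]
  have hθz : θ z = P z := by simp [θ, hrz, hvz]
  -- a small multiple of `Q q` is a value of `θ - P z` near `z`
  let e := hθ.toOpenPartialHomeomorph θ
  have hze : z ∈ e.source := hθ.mem_toOpenPartialHomeomorph_source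
  have hrc : Filter.Tendsto r (𝓝 z) (𝓝 z) := by
    have := hr.continuousAt.tendsto
    rwa [hrz] at this
  have hgood : ∀ᶠ x in 𝓝 z, r (r x) = r x ∧ v (r x) = 0 ∧ (fderiv ℝ v (r x) (v x) = v x) ∧
      (v x = 0 → r x = x) ∧ r x ∈ e.source := by
    filter_upwards [hrr, hvr, hvv, hns, hrc.eventually (e.open_source.mem_nhds hze)]
      with x h1 h2 h3 h4 h5 using ⟨h1, h2, h3, h4, h5⟩
  have himg : ∀ᶠ y in 𝓝 (θ z), ∃ x, (r (r x) = r x ∧ v (r x) = 0 ∧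
      (fderiv ℝ v (r x) (v x) = v x) ∧ (v x = 0 → r x = x) ∧ r x ∈ e.source) ∧ θ x = y := by
    rw [← hθ.map_nhds_eq_of_equiv, Filter.eventually_map]
    filter_upwards [hgood] with x hx using ⟨x, hx, rfl⟩
  have hline : Filter.Tendsto (fun t : ℝ => θ z + t • Q q) (𝓝 0) (𝓝 (θ z)) := by
    have : ContinuousAt (fun t : ℝ => θ z + t • Q q) 0 := by fun_prop
    simpa using this.tendsto
  obtain ⟨t, ht, htp⟩ := (((hline.eventually himg).filter_mono
    (nhdsWithin_le_nhds (s := Ioi 0))).and self_mem_nhdsWithin).exists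
  obtain ⟨x, ⟨h1, h2, h3, h4, h5⟩, hx⟩ := ht
  rw [hθz] at hx
  have hPx : P (r x) = P z := by
    have := congrArg P hx
    simpa [θ, eQ, ePP, ePC] using this
  -- `θ` takes the value `P z` at both `r x` and `z`, and it is injective near `z`.
  have hrx : r x = z := by
    refine e.injOn h5 hze ?_
    change θ (r x) = θ z
    rw [hθz]
    simp [θ, h1, h2, hPx]
  -- Applying `C` to `hx` gives `C (v x) = 0`, while `h3` at `r x = z` says `C (v x) = v x`.
  have hvx : v x = 0 := by
    have := congrArg C hx
    rw [hrx] at h3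
    have h6 : C (v x) = v x := h3
    simpa [θ, eQ, eCP, eCC, h6] using this
  have hxz : x = z := by rw [← h4 hvx, hrx]
  rw [hxz, hθz] at hx
  have htq : t • Q q = 0 := by simpa using hx.symm
  exact (smul_eq_zero.1 htq).resolve_left (ne_of_gt htp)

/-- A projection of a finite-dimensional space splits it as a product of Euclidean spaces. -/
theorem exists_continuousLinearEquiv_of_projection [FiniteDimensional ℝ E] (P : E →L[ℝ] E)
    (hP : ∀ w, P (P w) = P w) :
    ∃ (m k : ℕ) (e : E ≃L[ℝ] EuclideanSpace ℝ (Fin m) × EuclideanSpace ℝ (Fin k)),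
      (∀ w, e (P w) = ((e w).1, 0)) := by
  let R : Submodule ℝ E := LinearMap.range (P : E →ₗ[ℝ] E)
  let K : Submodule ℝ E := LinearMap.ker (P : E →ₗ[ℝ] E)
  have hRK : IsCompl R K := by
    rw [isCompl_iff]
    constructor
    · rw [Submodule.disjoint_def]
      rintro _ ⟨y, rfl⟩ hy
      have : P (P y) = 0 := hy
      rw [hP] at this
      exact this
    · rw [codisjoint_iff, eq_top_iff]
      intro x _
      refine Submodule.mem_sup.2 ⟨P x, ⟨x, rfl⟩, x - P x, ?_, by abel⟩
      simp [K, hP]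
  let e₁ : (R × K) ≃ₗ[ℝ] E := Submodule.prodEquivOfIsCompl R K hRK
  let a : R ≃ₗ[ℝ] EuclideanSpace ℝ (Fin (Module.finrank ℝ R)) :=
    LinearEquiv.ofFinrankEq _ _ (by simp)
  let b : K ≃ₗ[ℝ] EuclideanSpace ℝ (Fin (Module.finrank ℝ K)) :=
    LinearEquiv.ofFinrankEq _ _ (by simp)
  refine ⟨_, _, (e₁.symm.trans (a.prodCongr b)).toContinuousLinearEquiv, fun w => ?_⟩
  obtain ⟨⟨x, y⟩, rfl⟩ := e₁.surjective w
  have h1 : P (e₁ (x, y)) = e₁ (x, 0) := by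
    obtain ⟨x', hx'⟩ := x.2
    have hx : P x = x := by rw [← hx']; exact hP x'
    have hy : P y = 0 := y.2
    simp [e₁, hx, hy]
  rw [h1]
  simp

end Calculus

/-! ### Homogeneous structures in a chart -/

/-- The extension `g` is tied to the action only for `t ≥ 0`, hence the one-sided derivative; its
value is a partial derivative of `g`, which makes the dependence on `u` visible. -/
theorem hasDerivWithinAt_orbit_of_chart {n : ℕ} {F : Type*} [TopologicalSpace F] {h : ℝ≥0 → F → F}
    {φ ψ : OpenPartialHomeomorph F (EuclideanSpace ℝ (Fin n))} {u : F} (hu : u ∈ ψ.source)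
    {g : ℝ × EuclideanSpace ℝ (Fin n) → EuclideanSpace ℝ (Fin n)}
    (hg : DifferentiableAt ℝ g (0, ψ u)) (hgh : ∀ (t : ℝ≥0) z, g (t, z) = φ (h t (ψ.symm z))) :
    HasDerivWithinAt (fun t : ℝ => φ (h t.toNNReal u)) (fderiv ℝ g (0, ψ u) (1, 0)) (Ici 0) 0 := by
  have h1 : HasDerivAt (fun t : ℝ => (t, ψ u)) ((1 : ℝ), (0 : EuclideanSpace ℝ (Fin n))) 0 :=
    (hasDerivAt_id (0 : ℝ)).prodMk (hasDerivAt_const _ _)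
  have h2 : HasDerivAt (fun t : ℝ => g (t, ψ u)) (fderiv ℝ g (0, ψ u) (1, 0)) 0 :=
    HasFDerivAt.comp_hasDerivAt (f := fun t : ℝ => (t, ψ u)) (0 : ℝ) hg.hasFDerivAt h1
  refine h2.hasDerivWithinAt.congr (fun t ht => ?_) ?_
  · have := hgh t.toNNReal (ψ u)
    rw [Real.coe_toNNReal _ ht, ψ.left_inv hu] at this
    exact this.symm
  · have := hgh (0 : ℝ).toNNReal (ψ u)
    rw [Real.coe_toNNReal _ le_rfl, ψ.left_inv hu] at this
    exact this.symm

section Homogeneous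

variable {n : ℕ} {F : Type*} [TopologicalSpace F]
  [ChartedSpace (EuclideanSpace ℝ (Fin n)) F] [IsManifold (𝓡 n) ∞ F]
  {h : ℝ≥0 → F → F}

/-- The vertical lift read in a chart `φ`. -/
noncomputable def chartVerticalLift (φ : OpenPartialHomeomorph F (EuclideanSpace ℝ (Fin n)))
    (h : ℝ≥0 → F → F) (u : F) : EuclideanSpace ℝ (Fin n) :=
  derivWithin (fun t : ℝ => φ (h t.toNNReal u)) (Ici 0) 0

namespace IsHomogeneousStructure

theorem zero_act (hh : IsHomogeneousStructure n h) (t : ℝ≥0) (u : F) : h 0 (h t u) = h 0 u := by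
  rw [← hh.mul_act, zero_mul]

theorem act_zero (hh : IsHomogeneousStructure n h) (t : ℝ≥0) (u : F) : h t (h 0 u) = h 0 u := by
  rw [← hh.mul_act, mul_zero]

theorem act_of_mem (hh : IsHomogeneousStructure n h) {u : F} (hu : u ∈ range (h 0)) (t : ℝ≥0) :
    h t u = u := by
  obtain ⟨x, rfl⟩ := hu
  exact hh.act_zero t x

theorem mem_range_iff (hh : IsHomogeneousStructure n h) {u : F} :
    u ∈ range (h 0) ↔ h 0 u = u :=
  ⟨fun hu => hh.act_of_mem hu 0, fun hu => ⟨u, hu⟩⟩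

theorem inv_act (hh : IsHomogeneousStructure n h) {t : ℝ≥0} (ht : t ≠ 0) (u : F) :
    h t⁻¹ (h t u) = u := by
  rw [← hh.mul_act, inv_mul_cancel₀ ht, hh.one_act]

theorem contMDiff_act (hh : IsHomogeneousStructure n h) (t : ℝ≥0) :
    ContMDiff (𝓡 n) (𝓡 n) ∞ (h t) := by
  obtain ⟨U, H, hU, hIU, hH, hHh⟩ := hh.smooth
  have h1 : h t = H ∘ fun x => ((t : ℝ), x) := by
    ext x; exact (hHh t x).symm
  rw [h1, ← contMDiffOn_univ]
  refine hH.comp (t := U ×ˢ univ) (contMDiff_const.prodMk contMDiff_id).contMDiffOn ?_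
  intro x _
  exact ⟨hIU t.2, mem_univ _⟩

theorem continuous_act (hh : IsHomogeneousStructure n h) (t : ℝ≥0) : Continuous (h t) :=
  (hh.contMDiff_act t).continuous

theorem continuousWithinAt_orbit (hh : IsHomogeneousStructure n h) (u : F) :
    ContinuousWithinAt (fun t : ℝ => h t.toNNReal u) (Ici 0) 0 := by
  obtain ⟨U, H, hU, hIU, hH, hHh⟩ := hh.smooth
  have h1 : ContinuousAt H (0, u) :=
    hH.continuousOn.continuousAt ((hU.prod isOpen_univ).mem_nhds ⟨hIU self_mem_Ici, mem_univ _⟩)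
  have h2 : ContinuousAt (fun t : ℝ => H (t, u)) 0 :=
    ContinuousAt.comp (f := fun t : ℝ => (t, u)) h1 (by fun_prop)
  refine h2.continuousWithinAt.congr (fun t ht => ?_) ?_
  · rw [← hHh, Real.coe_toNNReal _ ht]
  · rw [← hHh, Real.coe_toNNReal _ le_rfl]

/-- In charts of `F` around `u` and `h 0 u`, the action near `(0, u)` extends to a smooth map of
normed spaces. -/
theorem exists_contDiffAt_chart (hh : IsHomogeneousStructure n h)
    {φ ψ : OpenPartialHomeomorph F (EuclideanSpace ℝ (Fin n))}
    (hφ : φ ∈ IsManifold.maximalAtlas (𝓡 n) ∞ F) (hψ : ψ ∈ IsManifold.maximalAtlas (𝓡 n) ∞ F)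
    {u : F} (hu : u ∈ ψ.source) (hu0 : h 0 u ∈ φ.source) :
    ∃ g : ℝ × EuclideanSpace ℝ (Fin n) → EuclideanSpace ℝ (Fin n), ContDiffAt ℝ ∞ g (0, ψ u) ∧
      ∀ (t : ℝ≥0) z, g (t, z) = φ (h t (ψ.symm z)) := by
  obtain ⟨U, H, hU, hIU, hH, hHh⟩ := hh.smooth
  refine ⟨fun q => φ (H (q.1, ψ.symm q.2)), ?_, fun t z => congrArg φ (hHh t _)⟩
  have h0 : H (0, u) = h 0 u := by simpa using hHh 0 u
  have h1 : ContMDiffAt (𝓘(ℝ, ℝ).prod (𝓡 n)) (𝓘(ℝ, ℝ).prod (𝓡 n)) ∞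
      (fun q : ℝ × EuclideanSpace ℝ (Fin n) => (q.1, ψ.symm q.2)) (0, ψ u) := by
    refine contMDiffAt_fst.prodMk ?_
    exact ContMDiffAt.comp (0, ψ u) (g := ψ.symm) (f := Prod.snd)
      (contMDiffAt_symm_of_mem_maximalAtlas hψ (ψ.map_source hu)) contMDiffAt_snd
  have h2 : ContMDiffAt (𝓘(ℝ, ℝ).prod (𝓡 n)) (𝓡 n) ∞ H (0, ψ.symm (ψ u)) := by
    rw [ψ.left_inv hu]
    exact hH.contMDiffAt ((hU.prod isOpen_univ).mem_nhds ⟨hIU self_mem_Ici, mem_univ _⟩)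
  have h3 : ContMDiffAt (𝓡 n) (𝓡 n) ∞ φ (H (0, ψ.symm (ψ u))) := by
    rw [ψ.left_inv hu, h0]
    exact contMDiffAt_of_mem_maximalAtlas hφ hu0
  have h4 : ContMDiffAt (𝓘(ℝ, ℝ).prod (𝓡 n)) (𝓡 n) ∞ (fun q => φ (H (q.1, ψ.symm q.2)))
      ((0 : ℝ), ψ u) :=
    ContMDiffAt.comp (0, ψ u) (g := φ) h3 (ContMDiffAt.comp (0, ψ u) (g := H) h2 h1)
  rw [← contMDiffAt_iff_contDiffAt, modelWithCornersSelf_prod, ← chartedSpaceSelf_prod]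
  exact h4

theorem hasDerivWithinAt_orbit (hh : IsHomogeneousStructure n h)
    {φ : OpenPartialHomeomorph F (EuclideanSpace ℝ (Fin n))}
    (hφ : φ ∈ IsManifold.maximalAtlas (𝓡 n) ∞ F) {u : F} (hu0 : h 0 u ∈ φ.source) :
    HasDerivWithinAt (fun t : ℝ => φ (h t.toNNReal u)) (chartVerticalLift φ h u) (Ici 0) 0 := by
  obtain ⟨g, hg, hgh⟩ := hh.exists_contDiffAt_chart hφ
    (IsManifold.chart_mem_maximalAtlas (I := 𝓡 n) (n := ∞) u) (mem_chart_source _ u) hu0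
  exact (hasDerivWithinAt_orbit_of_chart (mem_chart_source _ u) (hg.differentiableAt (by simp))
    hgh).differentiableWithinAt.hasDerivWithinAt

/-- Locally the vertical lift is the partial derivative in `t` at `t = 0` of a smooth extension of
the action. -/
theorem contMDiffOn_chartVerticalLift (hh : IsHomogeneousStructure n h)
    {φ : OpenPartialHomeomorph F (EuclideanSpace ℝ (Fin n))}
    (hφ : φ ∈ IsManifold.maximalAtlas (𝓡 n) ∞ F) :
    ContMDiffOn (𝓡 n) (𝓡 n) ∞ (chartVerticalLift φ h) (h 0 ⁻¹' φ.source) := by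
  intro u hu
  refine ContMDiffAt.contMDiffWithinAt ?_
  let ψ := chartAt (EuclideanSpace ℝ (Fin n)) u
  have hψ : ψ ∈ IsManifold.maximalAtlas (𝓡 n) ∞ F := IsManifold.chart_mem_maximalAtlas u
  have huψ : u ∈ ψ.source := mem_chart_source _ u
  obtain ⟨g, hg, hgh⟩ := hh.exists_contDiffAt_chart hφ hψ huψ hu
  have h1 : ContDiffAt ℝ ∞ (fun z => fderiv ℝ g (0, z) (1, 0)) (ψ u) := by
    have h2 : ContDiffAt ℝ ∞ (fderiv ℝ g) (0, ψ u) := hg.fderiv_right (by simp)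
    have h3 : ContDiffAt ℝ ∞ (fun z => fderiv ℝ g (0, z)) (ψ u) :=
      ContDiffAt.comp (ψ u) (g := fderiv ℝ g) (f := fun z => ((0 : ℝ), z)) h2
        (contDiffAt_const.prodMk contDiffAt_id)
    exact h3.clm_apply contDiffAt_const
  have h4 : ContMDiffAt (𝓡 n) (𝓡 n) ∞ (fun x => fderiv ℝ g (0, ψ x) (1, 0)) u :=
    ContMDiffAt.comp u (g := fun z => fderiv ℝ g (0, z) (1, 0)) (f := ψ) h1.contMDiffAt
      (contMDiffAt_of_mem_maximalAtlas hψ huψ)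
  refine h4.congr_of_eventuallyEq ?_
  have hd : ∀ᶠ z in 𝓝 (ψ u), DifferentiableAt ℝ g (0, z) := by
    have h5 : ∀ᶠ q in 𝓝 ((0 : ℝ), ψ u), DifferentiableAt ℝ g q :=
      ((hg.of_le (m := 1) (by norm_cast)).eventually (by simp)).mono
        fun q hq => hq.differentiableAt (by simp)
    have h6 : ContinuousAt (fun z : EuclideanSpace ℝ (Fin n) => ((0 : ℝ), z)) (ψ u) := by fun_prop
    exact h6.eventually h5
  filter_upwards [(ψ.continuousAt huψ).eventually hd, ψ.open_source.mem_nhds huψ] with x hx hxs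
  exact (hasDerivWithinAt_orbit_of_chart hxs hx hgh).derivWithin (uniqueDiffOn_Ici 0 0 self_mem_Ici)

/-- The orbit of `h s u` is that of `u` reparametrized by `t ↦ t * s`; this covers `s = 0`. -/
theorem chartVerticalLift_act (hh : IsHomogeneousStructure n h)
    {φ : OpenPartialHomeomorph F (EuclideanSpace ℝ (Fin n))}
    (hφ : φ ∈ IsManifold.maximalAtlas (𝓡 n) ∞ F) {u : F} (hu0 : h 0 u ∈ φ.source) (s : ℝ≥0) :
    chartVerticalLift φ h (h s u) = (s : ℝ) • chartVerticalLift φ h u := by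
  have h1 := hh.hasDerivWithinAt_orbit hφ hu0
  have h2 : HasDerivWithinAt (fun t : ℝ => t * s) s (Ici 0) 0 := by
    simpa using ((hasDerivAt_id (0 : ℝ)).mul_const (s : ℝ)).hasDerivWithinAt
  have h3 : HasDerivWithinAt ((fun t : ℝ => φ (h t.toNNReal u)) ∘ fun t : ℝ => t * s)
      ((s : ℝ) • chartVerticalLift φ h u) (Ici 0) 0 := by
    refine HasDerivWithinAt.scomp (t' := Ici 0) (0 : ℝ) (by simpa using h1) h2 ?_
    intro t ht
    exact mul_nonneg ht s.2
  have h4 : HasDerivWithinAt (fun t : ℝ => φ (h t.toNNReal (h s u)))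
      ((s : ℝ) • chartVerticalLift φ h u) (Ici 0) 0 := by
    refine h3.congr (fun t ht => ?_) ?_
    · simp [← hh.mul_act, Real.toNNReal_mul ht]
    · simp [← hh.mul_act]
  exact h4.derivWithin (uniqueDiffOn_Ici 0 0 self_mem_Ici)

theorem chartVerticalLift_of_mem (hh : IsHomogeneousStructure n h)
    (φ : OpenPartialHomeomorph F (EuclideanSpace ℝ (Fin n))) {u : F} (hu : u ∈ range (h 0)) :
    chartVerticalLift φ h u = 0 := by
  simp [chartVerticalLift, hh.act_of_mem hu]

theorem eventually_orbit_mem (hh : IsHomogeneousStructure n h) {s : Set F} (hs : IsOpen s) {u : F}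
    (hu0 : h 0 u ∈ s) : ∀ᶠ t : ℝ in 𝓝[≥] 0, h t.toNNReal u ∈ s := by
  have h1 := hh.continuousWithinAt_orbit u
  refine h1.eventually (hs.mem_nhds ?_)
  simpa using hu0

/-- Chain rule along the orbit, whose velocity at `0` is the vertical lift. It is applied to `h₀`
read in the chart, with `d = 0`, and to the vertical lift itself, with `c = 0`. -/
theorem fderiv_comp_symm_chartVerticalLift (hh : IsHomogeneousStructure n h)
    {φ : OpenPartialHomeomorph F (EuclideanSpace ℝ (Fin n))}
    (hφ : φ ∈ IsManifold.maximalAtlas (𝓡 n) ∞ F) {u : F} (hu0 : h 0 u ∈ φ.source)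
    {f : F → EuclideanSpace ℝ (Fin n)}
    (hf : DifferentiableAt ℝ (f ∘ φ.symm) (φ (h 0 u))) {c d : EuclideanSpace ℝ (Fin n)}
    (hfc : ∀ t : ℝ≥0, f (h t u) = c + (t : ℝ) • d) :
    fderiv ℝ (f ∘ φ.symm) (φ (h 0 u)) (chartVerticalLift φ h u) = d := by
  have h1 := hh.hasDerivWithinAt_orbit hφ hu0
  have h2 : HasDerivWithinAt ((f ∘ φ.symm) ∘ fun t : ℝ => φ (h t.toNNReal u))
      (fderiv ℝ (f ∘ φ.symm) (φ (h 0 u)) (chartVerticalLift φ h u)) (Ici 0) 0 := by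
    refine HasFDerivAt.comp_hasDerivWithinAt (0 : ℝ) ?_ h1
    simpa using hf.hasFDerivAt
  have h3 : HasDerivWithinAt (fun t : ℝ => c + t • d) d (Ici 0) 0 := by
    have h4 := ((hasDerivAt_id (0 : ℝ)).smul_const d).const_add c
    simpa using h4.hasDerivWithinAt
  refine (uniqueDiffOn_Ici 0 0 self_mem_Ici).eq_deriv _ (h2.congr_of_eventuallyEq ?_ ?_) h3
  · filter_upwards [hh.eventually_orbit_mem φ.open_source hu0, self_mem_nhdsWithin] with t ht ht0
    simp [φ.left_inv ht, hfc, Real.coe_toNNReal _ ht0]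
  · have := hfc 0
    simp only [NNReal.coe_zero, zero_smul, add_zero] at this
    simp [φ.left_inv hu0, this]

end IsHomogeneousStructure

end Homogeneous

/-! ### The vertical lift in charts and its derivative at fixed points -/

section Charts

variable {n : ℕ} {F : Type*} [TopologicalSpace F] [ChartedSpace (EuclideanSpace ℝ (Fin n)) F]

/-- All tangent spaces are definitionally the model space, so vectors over equal base points can be
compared without transport. -/
theorem tangentBundle_mk_congr {x y : F} (hxy : x = y) {v : TangentSpace (𝓡 n) x}
    {w : TangentSpace (𝓡 n) y}
    (hvw : (v : EuclideanSpace ℝ (Fin n)) = (w : EuclideanSpace ℝ (Fin n))) :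
    (⟨x, v⟩ : TangentBundle (𝓡 n) F) = ⟨y, w⟩ := by
  subst hxy
  exact congrArg (fun v : TangentSpace (𝓡 n) x => (⟨x, v⟩ : TangentBundle (𝓡 n) F)) hvw

theorem contDiffOn_comp_symm {φ : OpenPartialHomeomorph F (EuclideanSpace ℝ (Fin n))}
    (hφ : φ ∈ IsManifold.maximalAtlas (𝓡 n) ∞ F) {A : Set F}
    {f : F → EuclideanSpace ℝ (Fin n)} (hf : ContMDiffOn (𝓡 n) (𝓡 n) ∞ f A) :
    ContDiffOn ℝ ∞ (f ∘ φ.symm) (φ.target ∩ φ.symm ⁻¹' A) := by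
  rw [← contMDiffOn_iff_contDiffOn]
  exact hf.comp ((contMDiffOn_symm_of_mem_maximalAtlas hφ).mono inter_subset_left)
    inter_subset_right

end Charts

section Homogeneous

variable {n : ℕ} {F : Type*} [TopologicalSpace F]
  [ChartedSpace (EuclideanSpace ℝ (Fin n)) F] [IsManifold (𝓡 n) ∞ F]
  {h : ℝ≥0 → F → F}

@[simp]
theorem verticalLift_proj (u : F) : (verticalLift n h u).1 = h 0 u := by
  simp [verticalLift, tangentMapWithin]

/-- The vertical lift computed from a parametrization of the orbit by a curve in a normed space. -/
theorem verticalLift_eq {E' : Type*} [NormedAddCommGroup E'] [NormedSpace ℝ E'] {f : E' → F}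
    {c : ℝ → E'} {c' z : E'} {u : F} (hz : c 0 = z)
    (hc : HasDerivWithinAt c c' (Ici 0) 0)
    (hf : MDifferentiableAt 𝓘(ℝ, E') (𝓡 n) f z)
    (hfc : ∀ᶠ t : ℝ in 𝓝[≥] 0, h t.toNNReal u = f (c t)) :
    verticalLift n h u = ⟨f z, mfderiv 𝓘(ℝ, E') (𝓡 n) f z c'⟩ := by
  subst hz
  have h0 : h (0 : ℝ).toNNReal u = f (c 0) := hfc.self_of_nhdsWithin self_mem_Ici
  refine tangentBundle_mk_congr h0 ?_
  have h1 : MDifferentiableWithinAt 𝓘(ℝ, ℝ) 𝓘(ℝ, E') c (Ici 0) 0 :=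
    hc.differentiableWithinAt.mdifferentiableWithinAt
  have hu : UniqueMDiffWithinAt 𝓘(ℝ, ℝ) (Ici (0 : ℝ)) 0 :=
    (uniqueDiffOn_Ici (0 : ℝ) 0 self_mem_Ici).uniqueMDiffWithinAt
  have h2 : mfderivWithin 𝓘(ℝ, ℝ) (𝓡 n) (fun t : ℝ => h t.toNNReal u) (Ici 0) 0 =
      mfderivWithin 𝓘(ℝ, ℝ) (𝓡 n) (f ∘ c) (Ici 0) 0 :=
    Filter.EventuallyEq.mfderivWithin_eq hfc h0
  have h3 : mfderivWithin 𝓘(ℝ, ℝ) 𝓘(ℝ, E') c (Ici 0) 0 (1 : ℝ) = c' := by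
    rw [mfderivWithin_eq_fderivWithin]
    have := hc.hasFDerivWithinAt.fderivWithin (uniqueDiffOn_Ici (0 : ℝ) 0 self_mem_Ici)
    rw [this]
    exact one_smul ℝ c'
  change (mfderivWithin 𝓘(ℝ, ℝ) (𝓡 n) (fun t : ℝ => h t.toNNReal u) (Ici 0) 0) (1 : ℝ) = _
  rw [h2, mfderiv_comp_mfderivWithin (0 : ℝ) hf h1 hu]
  exact congrArg (mfderiv 𝓘(ℝ, E') (𝓡 n) f (c 0)) h3

/-- A chart in which the action `h` is `t ↦ P z + t (z - P z)` for a linear projection `P`, defined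
on a full preimage under `h 0`. -/
structure IsHomogeneousChart (h : ℝ≥0 → F → F)
    (P : EuclideanSpace ℝ (Fin n) →L[ℝ] EuclideanSpace ℝ (Fin n))
    (Θ : OpenPartialHomeomorph F (EuclideanSpace ℝ (Fin n))) : Prop where
  mem_maximalAtlas : Θ ∈ IsManifold.maximalAtlas (𝓡 n) ∞ F
  proj_proj : ∀ w, P (P w) = P w
  mem_source_iff : ∀ u, u ∈ Θ.source ↔ h 0 u ∈ Θ.source
  mem_target_iff : ∀ z, z ∈ Θ.target ↔ P z ∈ Θ.target
  map_act : ∀ u ∈ Θ.source, ∀ t : ℝ≥0, Θ (h t u) = P (Θ u) + (t : ℝ) • (Θ u - P (Θ u))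

namespace IsHomogeneousStructure

theorem verticalLift_eq_chart (hh : IsHomogeneousStructure n h)
    {φ : OpenPartialHomeomorph F (EuclideanSpace ℝ (Fin n))}
    (hφ : φ ∈ IsManifold.maximalAtlas (𝓡 n) ∞ F) {u : F} (hu0 : h 0 u ∈ φ.source) :
    verticalLift n h u = ⟨φ.symm (φ (h 0 u)),
      mfderiv (𝓡 n) (𝓡 n) φ.symm (φ (h 0 u)) (chartVerticalLift φ h u)⟩ := by
  have h1 := verticalLift_eq (f := φ.symm) (z := φ (h 0 u)) (by simp)
    (hh.hasDerivWithinAt_orbit hφ hu0)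
    ((contMDiffAt_symm_of_mem_maximalAtlas hφ (φ.map_source hu0)).mdifferentiableAt
      (by simp)) ((hh.eventually_orbit_mem φ.open_source hu0).mono
        fun t ht => (φ.left_inv ht).symm)
  exact h1

/-- The one place where nonsingularity of the homogeneous structure enters. -/
theorem mem_range_of_chartVerticalLift_eq_zero (hh : IsHomogeneousStructure n h)
    {φ : OpenPartialHomeomorph F (EuclideanSpace ℝ (Fin n))}
    (hφ : φ ∈ IsManifold.maximalAtlas (𝓡 n) ∞ F) {u : F} (hu0 : h 0 u ∈ φ.source)
    (hu : chartVerticalLift φ h u = 0) : u ∈ range (h 0) := by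
  refine hh.nonsingular u ?_
  rw [hh.verticalLift_eq_chart hφ hu0, hu]
  exact map_zero _

/-- In a chart around a point of `h₀(F)`, the derivatives of `h₀` and of the vertical lift are
complementary projections. -/
theorem exists_projection (hh : IsHomogeneousStructure n h)
    {φ : OpenPartialHomeomorph F (EuclideanSpace ℝ (Fin n))}
    (hφ : φ ∈ IsManifold.maximalAtlas (𝓡 n) ∞ F) {p : F} (hp : p ∈ φ.source)
    (hpN : p ∈ range (h 0)) :
    ∃ P : EuclideanSpace ℝ (Fin n) →L[ℝ] EuclideanSpace ℝ (Fin n),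
      (∀ w, P (P w) = P w) ∧ HasFDerivAt ((φ ∘ h 0) ∘ φ.symm) P (φ p) ∧
      HasFDerivAt (chartVerticalLift φ h ∘ φ.symm) (ContinuousLinearMap.id ℝ _ - P) (φ p) := by
  have hp0 : h 0 p = p := hh.act_of_mem hpN 0
  let A : Set F := h 0 ⁻¹' φ.source
  let D := φ.target ∩ φ.symm ⁻¹' A
  have hD : IsOpen D :=
    φ.isOpen_inter_preimage_symm (φ.open_source.preimage (hh.continuous_act 0))
  have hpD : φ p ∈ D := ⟨φ.map_source hp, by simp [A, φ.left_inv hp, hp0, hp]⟩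
  have hr : ContDiffOn ℝ ∞ ((φ ∘ h 0) ∘ φ.symm) D :=
    contDiffOn_comp_symm hφ ((contMDiffOn_of_mem_maximalAtlas hφ).comp
      (hh.contMDiff_act 0).contMDiffOn fun x hx => hx)
  have hv : ContDiffOn ℝ ∞ (chartVerticalLift φ h ∘ φ.symm) D :=
    contDiffOn_comp_symm hφ (hh.contMDiffOn_chartVerticalLift hφ)
  have hDn : ∀ᶠ z in 𝓝 (φ p), z ∈ D := hD.mem_nhds hpD
  have hback : ∀ z ∈ D, φ.symm (φ (h 0 (φ.symm z))) = h 0 (φ.symm z) :=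
    fun z hz => φ.left_inv hz.2
  have hdr : ∀ u, h 0 u ∈ φ.source → DifferentiableAt ℝ ((φ ∘ h 0) ∘ φ.symm) (φ (h 0 u)) ∧
      DifferentiableAt ℝ (chartVerticalLift φ h ∘ φ.symm) (φ (h 0 u)) := by
    intro u hu
    have hD' : φ (h 0 u) ∈ D := ⟨φ.map_source hu, by
      change h 0 (φ.symm (φ (h 0 u))) ∈ φ.source
      rw [φ.left_inv hu, hh.zero_act]; exact hu⟩
    exact ⟨(hr.contDiffAt (hD.mem_nhds hD')).differentiableAt (by simp),
      (hv.contDiffAt (hD.mem_nhds hD')).differentiableAt (by simp)⟩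
  have hrv : ∀ u, h 0 u ∈ φ.source →
      fderiv ℝ ((φ ∘ h 0) ∘ φ.symm) (φ (h 0 u)) (chartVerticalLift φ h u) = 0 := fun u hu =>
    hh.fderiv_comp_symm_chartVerticalLift hφ hu (hdr u hu).1 (c := φ (h 0 u)) fun t => by
      simp [hh.zero_act]
  have hvv : ∀ u, h 0 u ∈ φ.source →
      fderiv ℝ (chartVerticalLift φ h ∘ φ.symm) (φ (h 0 u)) (chartVerticalLift φ h u) =
        chartVerticalLift φ h u := fun u hu =>
    hh.fderiv_comp_symm_chartVerticalLift hφ hu (hdr u hu).2 (c := 0) fun t => by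
      rw [zero_add, hh.chartVerticalLift_act hφ hu]
  have hrp := hr.contDiffAt (hD.mem_nhds hpD)
  have hvp := hv.contDiffAt (hD.mem_nhds hpD)
  obtain ⟨h1, h2⟩ := fderiv_retraction_and_vertical hrp hvp
    (by simp [φ.left_inv hp, hp0])
    (by
      filter_upwards [hDn] with z hz
      simp [hback z hz, hh.zero_act])
    (by
      filter_upwards [hDn] with z hz
      simp only [Function.comp_apply, hback z hz]
      exact hh.chartVerticalLift_of_mem φ (mem_range_self _))
    (by
      filter_upwards [hDn] with z hz
      exact hrv _ hz.2)
    (by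
      filter_upwards [hDn] with z hz
      exact hvv _ hz.2)
    (by
      filter_upwards [hDn] with z hz hz0
      have := hh.mem_range_iff.1 (hh.mem_range_of_chartVerticalLift_eq_zero hφ hz.2 hz0)
      simp [this, φ.right_inv hz.1])
  exact ⟨_, h1, (hrp.differentiableAt (by simp)).hasFDerivAt,
    (hvp.differentiableAt (by simp)).hasFDerivAt.congr_fderiv (ContinuousLinearMap.ext h2)⟩

end IsHomogeneousStructure

end Homogeneous

/-! ### Charts linearizing the action -/

section Homogeneous

variable {n : ℕ} {F : Type*} [TopologicalSpace F]
  [ChartedSpace (EuclideanSpace ℝ (Fin n)) F] [IsManifold (𝓡 n) ∞ F]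
  {h : ℝ≥0 → F → F}

namespace IsHomogeneousStructure

/-- A local chart compatible with the action extends to a full preimage under `h₀`, because `h t`
is invertible for `t > 0`. -/
theorem exists_homogeneousChart_of_local (hh : IsHomogeneousStructure n h)
    {P : EuclideanSpace ℝ (Fin n) →L[ℝ] EuclideanSpace ℝ (Fin n)} (hP : ∀ w, P (P w) = P w)
    {A : Set F} (hA : ∀ u, h 0 u ∈ A → u ∈ A) {Θ : F → EuclideanSpace ℝ (Fin n)}
    (hΘ : ContMDiffOn (𝓡 n) (𝓡 n) ∞ Θ A)
    (hact : ∀ u ∈ A, ∀ t : ℝ≥0, Θ (h t u) = P (Θ u) + (t : ℝ) • (Θ u - P (Θ u)))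
    (e : OpenPartialHomeomorph F (EuclideanSpace ℝ (Fin n))) (heA : e.source ⊆ A)
    (he : EqOn Θ e e.source) (he' : ContMDiffOn (𝓡 n) (𝓡 n) ∞ e.symm e.target)
    {p : F} (hp : p ∈ e.source) (hpN : p ∈ range (h 0)) :
    ∃ Ψ : OpenPartialHomeomorph F (EuclideanSpace ℝ (Fin n)),
      IsHomogeneousChart h P Ψ ∧ p ∈ Ψ.source := by
  have : Nonempty F := ⟨p⟩
  let D : Set F := h 0 ⁻¹' e.source
  let B : Set (EuclideanSpace ℝ (Fin n)) := e.target ∩ e.symm ⁻¹' D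
  -- The expected image of `D`: with each of its points it contains the whole fibre of `P`.
  let T : Set (EuclideanSpace ℝ (Fin n)) := P ⁻¹' B
  have hD : IsOpen D := e.open_source.preimage (hh.continuous_act 0)
  have hB : IsOpen B := e.isOpen_inter_preimage_symm hD
  have hT : IsOpen T := hB.preimage P.continuous
  have hDA : D ⊆ A := fun u hu => hA u (heA hu)
  have hmaps : MapsTo Θ D T := by
    intro u hu
    have h1 : P (Θ u) = e (h 0 u) := by
      rw [← he hu, hact u (hDA hu)]
      simp
    change P (Θ u) ∈ B
    rw [h1]
    refine ⟨e.map_source hu, ?_⟩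
    change h 0 (e.symm (e (h 0 u))) ∈ e.source
    rwa [e.left_inv hu, hh.zero_act]
  -- A common `h t` with small `t > 0` brings both points into `e.source`, where `Θ` is injective;
  -- `h t` is then inverted.
  have hinj : InjOn Θ D := by
    intro u hu u' hu' huu
    obtain ⟨t, ⟨h1, h2⟩, ht⟩ := ((((hh.eventually_orbit_mem e.open_source hu).and
      (hh.eventually_orbit_mem e.open_source hu')).filter_mono
        (nhdsWithin_mono (0 : ℝ) Ioi_subset_Ici_self)).and self_mem_nhdsWithin).exists
    have h3 : Θ (h t.toNNReal u) = Θ (h t.toNNReal u') := by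
      rw [hact u (hDA hu), hact u' (hDA hu'), huu]
    rw [he h1, he h2] at h3
    have h4 := e.injOn h1 h2 h3
    have ht' : t.toNNReal ≠ 0 := (Real.toNNReal_pos.2 ht).ne'
    rw [← hh.inv_act ht' u, h4, hh.inv_act ht']
  -- A preimage of `z`: shrink the component `z - P z` by `s` to land in `B`, lift by `e.symm`, and
  -- undo the shrinking by `h s⁻¹`.
  have hlift : ∀ (s : ℝ≥0) z, s ≠ 0 → P z + (s : ℝ) • (z - P z) ∈ B →
      h s⁻¹ (e.symm (P z + (s : ℝ) • (z - P z))) ∈ D ∧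
        Θ (h s⁻¹ (e.symm (P z + (s : ℝ) • (z - P z)))) = z := by
    intro s z hs hz
    have h1 := e.map_target hz.1
    refine ⟨?_, ?_⟩
    · change h 0 (h s⁻¹ _) ∈ e.source
      rw [hh.zero_act]
      exact hz.2
    · have hs' : (s : ℝ) ≠ 0 := by exact_mod_cast hs
      rw [hact _ (heA h1), he h1, e.right_inv hz.1]
      simp [hP, hs']
  have hsmall : ∀ z ∈ T, ∃ s : ℝ≥0, s ≠ 0 ∧ P z + (s : ℝ) • (z - P z) ∈ B := by
    intro z hz
    have h1 : ContinuousAt (fun s : ℝ => P z + s • (z - P z)) 0 := by fun_prop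
    have h2 : ∀ᶠ s : ℝ in 𝓝 0, P z + s • (z - P z) ∈ B :=
      h1.eventually (hB.mem_nhds (by simpa using (show P z ∈ B from hz)))
    obtain ⟨s, h3, h4⟩ := ((h2.filter_mono
      (nhdsWithin_le_nhds (s := Ioi 0))).and self_mem_nhdsWithin).exists
    refine ⟨s.toNNReal, (Real.toNNReal_pos.2 h4).ne', ?_⟩
    rwa [Real.coe_toNNReal _ (le_of_lt h4)]
  have hbij : BijOn Θ D T := by
    refine ⟨hmaps, hinj, fun z hz => ?_⟩
    obtain ⟨s, hs, hzs⟩ := hsmall z hz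
    exact ⟨_, (hlift s z hs hzs).1, (hlift s z hs hzs).2⟩
  let e₁ : PartialEquiv F (EuclideanSpace ℝ (Fin n)) := hbij.toPartialEquiv
  have hΘD : ContMDiffOn (𝓡 n) (𝓡 n) ∞ Θ D := hΘ.mono hDA
  -- One factor `s` serves a whole neighbourhood of `z`, and by injectivity the inverse is there the
  -- smooth expression of `hlift`.
  have hsymm : ContMDiffOn (𝓡 n) (𝓡 n) ∞ e₁.symm T := by
    intro z hz
    obtain ⟨s, hs, hzs⟩ := hsmall z hz
    refine ContMDiffAt.contMDiffWithinAt ?_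
    have hlin : ContDiff ℝ ∞ (fun z => P z + (s : ℝ) • (z - P z)) := by fun_prop
    have h1 : ContMDiffAt (𝓡 n) (𝓡 n) ∞ e.symm (P z + (s : ℝ) • (z - P z)) :=
      he'.contMDiffAt (e.open_target.mem_nhds hzs.1)
    have h2 : ContMDiffAt (𝓡 n) (𝓡 n) ∞
        (fun z => h s⁻¹ (e.symm (P z + (s : ℝ) • (z - P z)))) z :=
      (hh.contMDiff_act s⁻¹).contMDiffAt.comp z
        (ContMDiffAt.comp z (g := e.symm) h1 hlin.contMDiff.contMDiffAt)
    refine h2.congr_of_eventuallyEq ?_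
    filter_upwards [hT.mem_nhds hz, hlin.continuous.continuousAt.eventually (hB.mem_nhds hzs)]
      with y hy hys
    obtain ⟨h3, h4⟩ := hlift s y hs hys
    refine hinj (e₁.map_target hy) h3 ?_
    rw [h4]
    exact e₁.right_inv hy
  let Ψ : OpenPartialHomeomorph F (EuclideanSpace ℝ (Fin n)) :=
    { e₁ with
      open_source := hD
      open_target := hT
      continuousOn_toFun := hΘD.continuousOn
      continuousOn_invFun := hsymm.continuousOn }
  refine ⟨Ψ, ⟨?_, hP, fun u => ?_, fun z => ?_, fun u hu t => hact u (hDA hu) t⟩, ?_⟩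
  · exact Ψ.mem_maximalAtlas_of_contMDiffOn hΘD hsymm
  · change h 0 u ∈ e.source ↔ h 0 (h 0 u) ∈ e.source
    rw [hh.zero_act]
  · change P z ∈ B ↔ P (P z) ∈ B
    rw [hP]
  · change h 0 p ∈ e.source
    rwa [hh.act_of_mem hpN]

/-- In `Θ = P ∘ φ ∘ h₀ + (1 - P) ∘ V` the first term is constant along orbits and the second is
homogeneous of degree one, so `Θ` linearizes the action. Its derivative at `p`, read in `φ`, is `P²
+ (1 - P)² = 1`, so the inverse function theorem makes it a local chart. -/
theorem exists_homogeneousChart (hh : IsHomogeneousStructure n h) {p : F}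
    (hpN : p ∈ range (h 0)) :
    ∃ (P : EuclideanSpace ℝ (Fin n) →L[ℝ] EuclideanSpace ℝ (Fin n))
      (Θ : OpenPartialHomeomorph F (EuclideanSpace ℝ (Fin n))),
      IsHomogeneousChart h P Θ ∧ p ∈ Θ.source := by
  let φ := chartAt (EuclideanSpace ℝ (Fin n)) p
  have hφ : φ ∈ IsManifold.maximalAtlas (𝓡 n) ∞ F := IsManifold.chart_mem_maximalAtlas p
  have hp : p ∈ φ.source := mem_chart_source _ p
  have hp0 : h 0 p = p := hh.act_of_mem hpN 0
  obtain ⟨P, hP, hr, hv⟩ := hh.exists_projection hφ hp hpN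
  let A : Set F := h 0 ⁻¹' φ.source
  let Θ : F → EuclideanSpace ℝ (Fin n) := fun u =>
    P (φ (h 0 u)) + (ContinuousLinearMap.id ℝ (EuclideanSpace ℝ (Fin n)) - P) (chartVerticalLift φ h u)
  have hΘ : ContMDiffOn (𝓡 n) (𝓡 n) ∞ Θ A := by
    have h1 : ContMDiffOn (𝓡 n) (𝓡 n) ∞ (fun u => P (φ (h 0 u))) A :=
      P.contMDiff.comp_contMDiffOn ((contMDiffOn_of_mem_maximalAtlas hφ).comp
        (hh.contMDiff_act 0).contMDiffOn fun x hx => hx)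
    have h2 : ContMDiffOn (𝓡 n) (𝓡 n) ∞
        (fun u => (ContinuousLinearMap.id ℝ (EuclideanSpace ℝ (Fin n)) - P) (chartVerticalLift φ h u)) A :=
      (ContinuousLinearMap.id ℝ (EuclideanSpace ℝ (Fin n)) - P).contMDiff.comp_contMDiffOn
        (hh.contMDiffOn_chartVerticalLift hφ)
    exact h1.add h2
  have hPΘ : ∀ u, P (Θ u) = P (φ (h 0 u)) := fun u => by simp [Θ, hP]
  have hact : ∀ u ∈ A, ∀ t : ℝ≥0, Θ (h t u) = P (Θ u) + (t : ℝ) • (Θ u - P (Θ u)) := by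
    intro u hu t
    rw [hPΘ]
    simp only [Θ, hh.zero_act, hh.chartVerticalLift_act hφ hu, map_smul, add_sub_cancel_left]
  have hAo : IsOpen A := φ.open_source.preimage (hh.continuous_act 0)
  have hder : HasFDerivAt (Θ ∘ φ.symm) (ContinuousLinearMap.id ℝ _) (φ p) := by
    have h1 := (P.hasFDerivAt.comp (φ p) hr).add
      ((ContinuousLinearMap.id ℝ (EuclideanSpace ℝ (Fin n)) - P).hasFDerivAt.comp (φ p) hv)
    refine h1.congr_fderiv ?_
    ext1 w
    simp [hP]
  obtain ⟨e, hpe, heD, hef, he⟩ := exists_openPartialHomeomorph_of_hasFDerivAt_id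
    (φ.isOpen_inter_preimage_symm hAo) (contDiffOn_comp_symm hφ hΘ)
    ⟨φ.map_source hp, by simp [A, φ.left_inv hp, hp0, hp]⟩ hder
  have hsrc : ∀ u ∈ (φ.trans e).source, u ∈ φ.source ∧ φ u ∈ e.source := fun u hu => by
    simpa using hu
  refine ⟨P, hh.exists_homogeneousChart_of_local hP (A := A) (fun u hu => ?_) hΘ hact (φ.trans e)
    (fun u hu => ?_) (fun u hu => ?_) ?_ ?_ hpN⟩
  · change h 0 u ∈ φ.source
    rw [← hh.zero_act 0]
    exact hu
  · have := (heD (hsrc u hu).2).2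
    rwa [mem_preimage, φ.left_inv (hsrc u hu).1] at this
  · change Θ u = e (φ u)
    rw [hef, Function.comp_apply, φ.left_inv (hsrc u hu).1]
  · rw [OpenPartialHomeomorph.trans_target, OpenPartialHomeomorph.coe_trans_symm]
    exact (contMDiffOn_symm_of_mem_maximalAtlas hφ).comp
      (he.contMDiffOn.mono inter_subset_left) inter_subset_right
  · simpa using ⟨hp, hpe⟩

end IsHomogeneousStructure

end Homogeneous

/-! ### Induced charts of the tangent bundle -/

section Charts

variable {n : ℕ} {F : Type*} [TopologicalSpace F] [ChartedSpace (EuclideanSpace ℝ (Fin n)) F]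

theorem mdifferentiable_of_mem_maximalAtlas
    {Θ : OpenPartialHomeomorph F (EuclideanSpace ℝ (Fin n))}
    (hΘ : Θ ∈ IsManifold.maximalAtlas (𝓡 n) ∞ F) : Θ.MDifferentiable (𝓡 n) (𝓡 n) :=
  ⟨(contMDiffOn_of_mem_maximalAtlas hΘ).mdifferentiableOn (by simp),
    (contMDiffOn_symm_of_mem_maximalAtlas hΘ).mdifferentiableOn (by simp)⟩

theorem IsHomogeneousChart.map_zero_act {h : ℝ≥0 → F → F}
    {P : EuclideanSpace ℝ (Fin n) →L[ℝ] EuclideanSpace ℝ (Fin n)}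
    {Θ : OpenPartialHomeomorph F (EuclideanSpace ℝ (Fin n))} (hΘ : IsHomogeneousChart h P Θ) {u : F} (hu : u ∈ Θ.source) :
    Θ (h 0 u) = P (Θ u) := by
  simp [hΘ.map_act u hu]

end Charts

section Homogeneous

variable {n : ℕ} {F : Type*} [TopologicalSpace F]
  [ChartedSpace (EuclideanSpace ℝ (Fin n)) F] [IsManifold (𝓡 n) ∞ F]

/-- The chart of the tangent bundle induced by a chart of the manifold. -/
noncomputable def tangentChart (Θ : OpenPartialHomeomorph F (EuclideanSpace ℝ (Fin n)))
    (hΘ : Θ ∈ IsManifold.maximalAtlas (𝓡 n) ∞ F) :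
    OpenPartialHomeomorph (TangentBundle (𝓡 n) F)
      (ModelProd (EuclideanSpace ℝ (Fin n)) (EuclideanSpace ℝ (Fin n))) where
  toFun v := (Θ v.1, mfderiv (𝓡 n) (𝓡 n) Θ v.1 v.2)
  invFun q := ⟨Θ.symm q.1, mfderiv (𝓡 n) (𝓡 n) Θ.symm q.1 q.2⟩
  source := Bundle.TotalSpace.proj ⁻¹' Θ.source
  target := Prod.fst ⁻¹' Θ.target
  map_source' v hv := Θ.map_source hv
  map_target' q hq := Θ.map_target hq
  left_inv' v hv := by
    refine tangentBundle_mk_congr (Θ.left_inv hv) ?_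
    have := (mdifferentiable_of_mem_maximalAtlas hΘ).symm_comp_deriv hv
    exact congrArg (fun f : EuclideanSpace ℝ (Fin n) →L[ℝ] EuclideanSpace ℝ (Fin n) => f v.2) this
  right_inv' q hq := by
    refine Prod.ext (Θ.right_inv hq) ?_
    have := (mdifferentiable_of_mem_maximalAtlas hΘ).comp_symm_deriv hq
    exact congrArg (fun f : EuclideanSpace ℝ (Fin n) →L[ℝ] EuclideanSpace ℝ (Fin n) => f q.2) this
  open_source := Θ.open_source.preimage (FiberBundle.continuous_proj _ _)
  open_target := Θ.open_target.preimage continuous_fst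
  continuousOn_toFun := by
    have h1 := (contMDiffOn_of_mem_maximalAtlas hΘ).continuousOn_tangentMapWithin (by simp)
      Θ.open_source.uniqueMDiffOn
    refine ((tangentBundleModelSpaceHomeomorph (𝓡 n)).continuous.comp_continuousOn h1).congr ?_
    intro v hv
    rw [Function.comp_apply, tangentMapWithin_eq_tangentMap (Θ.open_source.uniqueMDiffOn _ hv)
      ((mdifferentiable_of_mem_maximalAtlas hΘ).mdifferentiableAt hv)]
    rfl
  continuousOn_invFun := by
    have h1 := (contMDiffOn_symm_of_mem_maximalAtlas hΘ).continuousOn_tangentMapWithin (by simp)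
      Θ.open_target.uniqueMDiffOn
    refine (h1.comp (tangentBundleModelSpaceHomeomorph (𝓡 n)).symm.continuous.continuousOn
      (s := Prod.fst ⁻¹' Θ.target) fun q hq => hq).congr ?_
    intro q hq
    exact (tangentMapWithin_eq_tangentMap (p := ⟨q.1, q.2⟩) (Θ.open_target.uniqueMDiffOn _ hq)
      ((mdifferentiable_of_mem_maximalAtlas hΘ).symm.mdifferentiableAt hq)).symm

theorem tangentChart_mem_maximalAtlas {Θ : OpenPartialHomeomorph F (EuclideanSpace ℝ (Fin n))}
    (hΘ : Θ ∈ IsManifold.maximalAtlas (𝓡 n) ∞ F) :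
    tangentChart Θ hΘ ∈ IsManifold.maximalAtlas (𝓡 n).tangent ∞ (TangentBundle (𝓡 n) F) := by
  refine (tangentChart Θ hΘ).mem_maximalAtlas_of_contMDiffOn ?_ ?_
  · have h1 := (contMDiffOn_of_mem_maximalAtlas hΘ).contMDiffOn_tangentMapWithin (m := ∞) (by simp)
      Θ.open_source.uniqueMDiffOn
    refine (contMDiff_tangentBundleModelSpaceHomeomorph.comp_contMDiffOn h1).congr ?_
    intro v hv
    rw [Function.comp_apply, tangentMapWithin_eq_tangentMap (Θ.open_source.uniqueMDiffOn _ hv)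
      ((mdifferentiable_of_mem_maximalAtlas hΘ).mdifferentiableAt hv)]
    rfl
  · have h1 := (contMDiffOn_symm_of_mem_maximalAtlas hΘ).contMDiffOn_tangentMapWithin (m := ∞)
      (by simp) Θ.open_target.uniqueMDiffOn
    have h2 : ContMDiffOn (𝓡 n).tangent (𝓡 n).tangent ∞
        (tangentBundleModelSpaceHomeomorph (𝓡 n)).symm (tangentChart Θ hΘ).target :=
      contMDiff_tangentBundleModelSpaceHomeomorph_symm.contMDiffOn
    refine (h1.comp h2 fun q hq => hq).congr ?_
    intro q hq
    exact (tangentMapWithin_eq_tangentMap (p := ⟨q.1, q.2⟩) (Θ.open_target.uniqueMDiffOn _ hq)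
      ((mdifferentiable_of_mem_maximalAtlas hΘ).symm.mdifferentiableAt hq)).symm

variable {h : ℝ≥0 → F → F} {P : EuclideanSpace ℝ (Fin n) →L[ℝ] EuclideanSpace ℝ (Fin n)}
  {Θ : OpenPartialHomeomorph F (EuclideanSpace ℝ (Fin n))}

namespace IsHomogeneousChart

theorem act_mem_source (hΘ : IsHomogeneousChart h P Θ) (hh : IsHomogeneousStructure n h) {u : F}
    (hu : u ∈ Θ.source) (t : ℝ≥0) : h t u ∈ Θ.source := by
  rw [hΘ.mem_source_iff, hh.zero_act, ← hΘ.mem_source_iff]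
  exact hu

theorem mem_range_iff (hΘ : IsHomogeneousChart h P Θ) (hh : IsHomogeneousStructure n h) {u : F}
    (hu : u ∈ Θ.source) : u ∈ range (h 0) ↔ P (Θ u) = Θ u := by
  rw [hh.mem_range_iff, ← hΘ.map_zero_act hu]
  exact (Θ.injOn.eq_iff (hΘ.act_mem_source hh hu 0) hu).symm

/-- In `Θ` the orbit is the ray `t ↦ P z + t (z - P z)`. Injectivity, image, immersion and embedding
are all read off from this formula. -/
theorem tangentChart_verticalLift (hΘ : IsHomogeneousChart h P Θ)
    (hh : IsHomogeneousStructure n h) {u : F} (hu : u ∈ Θ.source) :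
    tangentChart Θ hΘ.mem_maximalAtlas (verticalLift n h u) = (P (Θ u), Θ u - P (Θ u)) := by
  have hz : P (Θ u) ∈ Θ.target := (hΘ.mem_target_iff _).1 (Θ.map_source hu)
  have hc : HasDerivWithinAt (fun t : ℝ => P (Θ u) + t • (Θ u - P (Θ u))) (Θ u - P (Θ u))
      (Ici 0) 0 := by
    simpa using (((hasDerivAt_id (0 : ℝ)).smul_const
      (Θ u - P (Θ u))).const_add (P (Θ u))).hasDerivWithinAt
  have h1 : verticalLift n h u = (tangentChart Θ hΘ.mem_maximalAtlas).symm
      (P (Θ u), Θ u - P (Θ u)) := by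
    refine verticalLift_eq (f := Θ.symm) (by simp) hc
      ((mdifferentiable_of_mem_maximalAtlas hΘ.mem_maximalAtlas).symm.mdifferentiableAt hz) ?_
    filter_upwards [self_mem_nhdsWithin] with t ht
    have h2 := hΘ.map_act u hu t.toNNReal
    rw [Real.coe_toNNReal _ ht] at h2
    rw [← h2, Θ.left_inv (hΘ.act_mem_source hh hu _)]
  rw [h1]
  exact (tangentChart Θ hΘ.mem_maximalAtlas).right_inv hz

/-- Differentiating `Θ ∘ h 0 = P ∘ Θ` turns the kernel of `d h₀` into that of `P`, because the
derivative of `Θ` is injective. -/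
theorem mem_verticalVectors_iff (hΘ : IsHomogeneousChart h P Θ)
    (hh : IsHomogeneousStructure n h) {v : TangentBundle (𝓡 n) F} (hv : v.1 ∈ Θ.source) :
    v ∈ verticalVectors n h ↔ P (tangentChart Θ hΘ.mem_maximalAtlas v).1 =
        (tangentChart Θ hΘ.mem_maximalAtlas v).1 ∧
      P (tangentChart Θ hΘ.mem_maximalAtlas v).2 = 0 := by
  obtain ⟨b, v⟩ := v
  have hb : b ∈ Θ.source := hv
  have hd := mdifferentiable_of_mem_maximalAtlas hΘ.mem_maximalAtlas
  refine and_congr (hΘ.mem_range_iff hh hb) ?_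
  have hb0 : h 0 b ∈ Θ.source := hΘ.act_mem_source hh hb 0
  have h1 : mfderiv (𝓡 n) (𝓡 n) (Θ ∘ h 0) b =
      (mfderiv (𝓡 n) (𝓡 n) Θ (h 0 b)).comp (mfderiv (𝓡 n) (𝓡 n) (h 0) b) :=
    mfderiv_comp b (hd.mdifferentiableAt hb0)
      ((hh.contMDiff_act 0).mdifferentiableAt (by simp))
  have h2 : mfderiv (𝓡 n) (𝓡 n) (P ∘ Θ) b =
      (mfderiv (𝓡 n) (𝓡 n) P (Θ b)).comp (mfderiv (𝓡 n) (𝓡 n) Θ b) :=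
    mfderiv_comp b P.mdifferentiableAt (hd.mdifferentiableAt hb)
  have h3 : mfderiv (𝓡 n) (𝓡 n) (Θ ∘ h 0) b = mfderiv (𝓡 n) (𝓡 n) (P ∘ Θ) b := by
    refine Filter.EventuallyEq.mfderiv_eq ?_
    filter_upwards [Θ.open_source.mem_nhds hb] with u hu using hΘ.map_zero_act hu
  rw [h1, h2, ContinuousLinearMap.mfderiv_eq] at h3
  have h4 : mfderiv (𝓡 n) (𝓡 n) Θ (h 0 b) (mfderiv (𝓡 n) (𝓡 n) (h 0) b v) =
      P (mfderiv (𝓡 n) (𝓡 n) Θ b v) :=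
    congrArg (fun f : EuclideanSpace ℝ (Fin n) →L[ℝ] EuclideanSpace ℝ (Fin n) => f v) h3
  change _ ↔ P (mfderiv (𝓡 n) (𝓡 n) Θ b v) = 0
  rw [← h4]
  constructor
  · intro h5
    have h5' : mfderiv (𝓡 n) (𝓡 n) (h 0) b v = 0 := h5
    rw [h5', map_zero]
    rfl
  · intro h5
    refine hd.mfderiv_injective hb0 ?_
    rw [map_zero]
    exact h5

end IsHomogeneousChart

end Homogeneous

/-! ### The submanifold, the vertical subbundle and the embedding -/

section Homogeneous

variable {n : ℕ} {F : Type*} [TopologicalSpace F]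
  [ChartedSpace (EuclideanSpace ℝ (Fin n)) F] [IsManifold (𝓡 n) ∞ F] {h : ℝ≥0 → F → F}

namespace IsHomogeneousStructure

theorem exists_homogeneousChart_of_point (hh : IsHomogeneousStructure n h) (u : F) :
    ∃ (P : EuclideanSpace ℝ (Fin n) →L[ℝ] EuclideanSpace ℝ (Fin n))
      (Θ : OpenPartialHomeomorph F (EuclideanSpace ℝ (Fin n))),
      IsHomogeneousChart h P Θ ∧ u ∈ Θ.source := by
  obtain ⟨P, Θ, hΘ, hu⟩ := hh.exists_homogeneousChart (mem_range_self (f := h 0) u)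
  exact ⟨P, Θ, hΘ, (hΘ.mem_source_iff u).2 hu⟩

theorem verticalLift_injective (hh : IsHomogeneousStructure n h) :
    Function.Injective (verticalLift n h) := by
  intro u u' huu
  obtain ⟨P, Θ, hΘ, hu⟩ := hh.exists_homogeneousChart_of_point u
  have hu' : u' ∈ Θ.source := by
    have h0 : h 0 u = h 0 u' := by
      rw [← verticalLift_proj (n := n) (h := h), huu, verticalLift_proj]
    rw [hΘ.mem_source_iff, ← h0, ← hΘ.mem_source_iff]
    exact hu
  have h1 := hΘ.tangentChart_verticalLift hh hu
  rw [huu, hΘ.tangentChart_verticalLift hh hu'] at h1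
  have h2 : P (Θ u') = P (Θ u) := congrArg Prod.fst h1
  have h3 : Θ u' - P (Θ u') = Θ u - P (Θ u) := congrArg Prod.snd h1
  rw [h2] at h3
  exact (Θ.injOn hu' hu (sub_left_injective h3)).symm

/-- In coordinates a vertical vector is a pair `(a, w)` with `P a = a` and `P w = 0`; it is the lift
of the point with coordinate `a + w`, which lies in the target because `P (a + w) = a` does. -/
theorem range_verticalLift (hh : IsHomogeneousStructure n h) :
    range (verticalLift n h) = verticalVectors n h := by
  apply Subset.antisymm
  · rintro _ ⟨u, rfl⟩
    obtain ⟨P, Θ, hΘ, hu⟩ := hh.exists_homogeneousChart_of_point u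
    rw [hΘ.mem_verticalVectors_iff hh (by simpa using hΘ.act_mem_source hh hu 0),
      hΘ.tangentChart_verticalLift hh hu]
    simp [hΘ.proj_proj]
  · intro v hv
    obtain ⟨P, Θ, hΘ, hvs⟩ := hh.exists_homogeneousChart hv.1
    rw [hΘ.mem_verticalVectors_iff hh hvs] at hv
    set T := tangentChart Θ hΘ.mem_maximalAtlas with hT
    have hvT : v ∈ T.source := hvs
    have h1 : P ((T v).1 + (T v).2) = (T v).1 := by rw [map_add, hv.1, hv.2, add_zero]
    have hz : (T v).1 + (T v).2 ∈ Θ.target := by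
      rw [hΘ.mem_target_iff, h1]
      exact T.map_source hvT
    have hu : Θ.symm ((T v).1 + (T v).2) ∈ Θ.source := Θ.map_target hz
    refine ⟨Θ.symm ((T v).1 + (T v).2), T.injOn ?_ hvT ?_⟩
    · change (verticalLift n h _).1 ∈ Θ.source
      rw [verticalLift_proj]
      exact hΘ.act_mem_source hh hu 0
    · rw [hT, hΘ.tangentChart_verticalLift hh hu, ← hT, Θ.right_inv hz, h1]
      simp

/-- A neighbourhood of a point of `h₀(F)`, saturated for `h₀`, has a product chart in which the
action is the scalar multiplication of the second component, which is a linear function of the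
vertical lift. -/
theorem exists_productChart (hh : IsHomogeneousStructure n h) {p : F} (hp : p ∈ range (h 0)) :
    ∃ (m k : ℕ) (W : Set (EuclideanSpace ℝ (Fin m)))
      (Φ : OpenPartialHomeomorph F (EuclideanSpace ℝ (Fin m) × EuclideanSpace ℝ (Fin k)))
      (L : F → EuclideanSpace ℝ (Fin n) →L[ℝ] EuclideanSpace ℝ (Fin k)),
      p ∈ Φ.source ∧ IsSmoothProductChart (𝓡 n) Φ ∧ Φ.target = W ×ˢ univ ∧
      (∀ u, u ∈ Φ.source ↔ h 0 u ∈ Φ.source) ∧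
      (∀ u ∈ Φ.source, Φ (h 0 u) = ((Φ u).1, 0)) ∧
      ∀ u ∈ Φ.source, (Φ u).2 = L (h 0 u) (verticalLift n h u).2 := by
  obtain ⟨P, Θ, hΘ, hpΘ⟩ := hh.exists_homogeneousChart hp
  obtain ⟨m, k, e, he⟩ := exists_continuousLinearEquiv_of_projection P hΘ.proj_proj
  refine ⟨m, k, {x | e.symm (x, 0) ∈ Θ.target},
    Θ.trans e.toHomeomorph.toOpenPartialHomeomorph,
    -- The derivative of `Θ` at the base point sends the vertical lift of `u` to `Θ u - P (Θ u)`,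
    -- whose second component under `e` is that of `Θ u`.
    fun b => ((ContinuousLinearMap.snd ℝ _ _).comp e.toContinuousLinearMap).comp
      (show EuclideanSpace ℝ (Fin n) →L[ℝ] EuclideanSpace ℝ (Fin n) from
        mfderiv (𝓡 n) (𝓡 n) Θ b), by simpa using hpΘ, ⟨?_, ?_⟩, ?_, ?_, ?_, ?_⟩
  · have h1 := e.contDiff.contMDiff.comp_contMDiffOn
      (contMDiffOn_of_mem_maximalAtlas hΘ.mem_maximalAtlas)
    exact h1.mono (by simp)
  · refine (contMDiffOn_symm_of_mem_maximalAtlas hΘ.mem_maximalAtlas).comp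
      (e.symm.contDiff.contMDiff.contMDiffOn (s := e.symm ⁻¹' Θ.target)) (fun x hx => hx) |>.mono ?_
    intro x hx
    simpa using hx
  · ext ⟨x, y⟩
    have h1 : P (e.symm (x, y)) = e.symm (x, 0) := by
      rw [← e.injective.eq_iff, he]
      simp
    have h2 := hΘ.mem_target_iff (e.symm (x, y))
    rw [h1] at h2
    simpa using h2
  · intro u
    simpa using hΘ.mem_source_iff u
  · intro u hu
    have hu' : u ∈ Θ.source := by simpa using hu
    change e (Θ (h 0 u)) = ((e (Θ u)).1, 0)
    rw [hΘ.map_zero_act hu', he]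
  · intro u hu
    have hu' : u ∈ Θ.source := by simpa using hu
    have h1 := hΘ.tangentChart_verticalLift hh hu'
    have h2 : mfderiv (𝓡 n) (𝓡 n) Θ (verticalLift n h u).1 (verticalLift n h u).2 =
      Θ u - P (Θ u) := congrArg Prod.snd h1
    rw [verticalLift_proj] at h2
    change (e (Θ u)).2 = (e (mfderiv (𝓡 n) (𝓡 n) Θ (h 0 u) (verticalLift n h u).2)).2
    rw [h2, map_sub, he]
    simp

theorem isEmbeddedSubmanifold (hh : IsHomogeneousStructure n h) :
    IsEmbeddedSubmanifold (𝓡 n) (range (h 0)) := by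
  intro p hp
  obtain ⟨m, k, W, Φ, L, hpΦ, hΦ, -, hsrc, hzero, -⟩ := hh.exists_productChart hp
  refine ⟨m, k, Φ, hpΦ, hΦ, fun u hu => ?_⟩
  rw [hh.mem_range_iff, ← Φ.injOn.eq_iff ((hsrc u).1 hu) hu, hzero u hu]
  simp [Prod.ext_iff, eq_comm]

/-- The frame consists of the vector fields that are constant in the chart `Θ`, with values in a
basis of the kernel of `P`. -/
theorem isTangentSubbundleOver (hh : IsHomogeneousStructure n h) :
    IsTangentSubbundleOver n (range (h 0)) (verticalVectors n h) := by
  refine ⟨hh.isEmbeddedSubmanifold, fun v hv => hv.1, fun p hp => ?_⟩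
  obtain ⟨P, Θ, hΘ, hpΘ⟩ := hh.exists_homogeneousChart hp
  let K : Submodule ℝ (EuclideanSpace ℝ (Fin n)) :=
    LinearMap.ker (P : EuclideanSpace ℝ (Fin n) →ₗ[ℝ] EuclideanSpace ℝ (Fin n))
  let b := Module.finBasis ℝ K
  let w : Fin (Module.finrank ℝ K) → EuclideanSpace ℝ (Fin n) := fun i => b i
  have hwi : LinearIndependent ℝ w := b.linearIndependent.map' K.subtype K.ker_subtype
  have hws : Submodule.span ℝ (range w) = K := by
    have h1 : range w = K.subtype '' range b := by
      rw [← range_comp]; rfl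
    rw [h1, Submodule.span_image, b.span_eq, Submodule.map_top, Submodule.range_subtype]
  have hd := mdifferentiable_of_mem_maximalAtlas hΘ.mem_maximalAtlas
  let T := tangentChart Θ hΘ.mem_maximalAtlas
  have hT := tangentChart_mem_maximalAtlas hΘ.mem_maximalAtlas
  refine ⟨Θ.source, Module.finrank ℝ K, fun i q => mfderiv (𝓡 n) (𝓡 n) Θ.symm (Θ q) (w i),
    Θ.open_source, hpΘ, fun i => ?_, fun q hq => ?_⟩
  · let f : F → ModelProd (EuclideanSpace ℝ (Fin n)) (EuclideanSpace ℝ (Fin n)) :=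
      fun q => (Θ q, w i)
    have h1 : ContMDiffOn (𝓡 n) (𝓡 n).tangent ∞ f Θ.source := by
      have hprod : prodChartedSpace (EuclideanSpace ℝ (Fin n)) (EuclideanSpace ℝ (Fin n))
          (EuclideanSpace ℝ (Fin n)) (EuclideanSpace ℝ (Fin n)) = chartedSpaceSelf
            (ModelProd (EuclideanSpace ℝ (Fin n)) (EuclideanSpace ℝ (Fin n))) :=
        chartedSpaceSelf_prod
      rw [← hprod]
      exact (contMDiffOn_of_mem_maximalAtlas hΘ.mem_maximalAtlas).prodMk contMDiffOn_const
    have h2 : ContMDiffOn (𝓡 n).tangent (𝓡 n).tangent ∞ T.symm T.target :=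
      contMDiffOn_symm_of_mem_maximalAtlas hT
    refine (h2.comp h1 fun q hq => Θ.map_source hq).congr fun q hq => ?_
    exact tangentBundle_mk_congr (Θ.left_inv hq).symm rfl
  · let A : EuclideanSpace ℝ (Fin n) →L[ℝ] EuclideanSpace ℝ (Fin n) :=
      mfderiv (𝓡 n) (𝓡 n) Θ.symm (Θ q)
    let B : EuclideanSpace ℝ (Fin n) →L[ℝ] EuclideanSpace ℝ (Fin n) := mfderiv (𝓡 n) (𝓡 n) Θ q
    have hAB : ∀ v, A (B v) = v := fun v => congrArg
      (fun f : EuclideanSpace ℝ (Fin n) →L[ℝ] EuclideanSpace ℝ (Fin n) => f v)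
      (hd.symm_comp_deriv hq.1)
    have hBA : ∀ v, B (A v) = v := fun v => by
      have h1 := hd.comp_symm_deriv (Θ.map_source hq.1)
      rw [Θ.left_inv hq.1] at h1
      exact congrArg
        (fun f : EuclideanSpace ℝ (Fin n) →L[ℝ] EuclideanSpace ℝ (Fin n) => f v) h1
    have hker : LinearMap.ker (A : EuclideanSpace ℝ (Fin n) →ₗ[ℝ] EuclideanSpace ℝ (Fin n)) = ⊥ :=
      LinearMap.ker_eq_bot.2 (Function.LeftInverse.injective hBA)
    refine ⟨hwi.map' _ hker, fun v => ?_⟩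
    have h1 : (range fun i => A (w i)) =
        (A : EuclideanSpace ℝ (Fin n) →ₗ[ℝ] EuclideanSpace ℝ (Fin n)) '' range w := by
      rw [← range_comp]; rfl
    have h2 : (v ∈ Submodule.span ℝ (range fun i => A (w i))) ↔ P (B v) = 0 := by
      rw [h1, Submodule.span_image, hws]
      constructor
      · rintro ⟨y, hy, rfl⟩
        have : P (B (A y)) = 0 := by rw [hBA]; exact hy
        exact this
      · exact fun hv => ⟨B v, hv, hAB v⟩
    refine Iff.trans ?_ h2.symm
    rw [hΘ.mem_verticalVectors_iff hh hq.1]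
    exact and_iff_right ((hΘ.mem_range_iff hh hq.1).1 hq.2)

end IsHomogeneousStructure

/-- The splitting of a projection, as an involution of the square of the space. -/
def projectionInvolution {E : Type*} [NormedAddCommGroup E] [NormedSpace ℝ E] (P : E →L[ℝ] E)
    (hP : ∀ w, P (P w) = P w) : (E × E) ≃L[ℝ] (E × E) :=
  let f : (E × E) →L[ℝ] (E × E) :=
    (P.comp (.fst ℝ E E) + (.id ℝ E - P).comp (.snd ℝ E E)).prod
      ((.id ℝ E - P).comp (.fst ℝ E E) + P.comp (.snd ℝ E E))
  have hf : Function.LeftInverse f f := fun x => by ext <;> simp [f, hP]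
  .equivOfInverse f f hf hf

theorem projectionInvolution_zero {E : Type*} [NormedAddCommGroup E] [NormedSpace ℝ E]
    (P : E →L[ℝ] E) (hP : ∀ w, P (P w) = P w) (z : E) :
    projectionInvolution P hP (z, 0) = (P z, z - P z) := by
  simp [projectionInvolution]

namespace IsHomogeneousStructure

/-- In charts the lift is `z ↦ (P z, z - P z)`, the restriction to `z ↦ (z, 0)` of a linear
automorphism; the complement is thus a copy of the model space. -/
theorem isImmersion_verticalLift (hh : IsHomogeneousStructure n h) :
    Manifold.IsImmersion (𝓡 n) (𝓡 n).tangent ∞ (verticalLift n h) := by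
  refine Manifold.IsImmersionOfComplement.isImmersion (F := EuclideanSpace ℝ (Fin n)) fun u => ?_
  obtain ⟨P, Θ, hΘ, hu⟩ := hh.exists_homogeneousChart_of_point u
  have hsrc : ∀ x ∈ Θ.source,
      verticalLift n h x ∈ (tangentChart Θ hΘ.mem_maximalAtlas).source := fun x hx => by
    change (verticalLift n h x).1 ∈ Θ.source
    rw [verticalLift_proj]
    exact hΘ.act_mem_source hh hx 0
  refine .mk_of_charts (projectionInvolution P hΘ.proj_proj) Θ
    (tangentChart Θ hΘ.mem_maximalAtlas) hu (hsrc u hu) hΘ.mem_maximalAtlas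
    (tangentChart_mem_maximalAtlas hΘ.mem_maximalAtlas) hsrc ?_
  intro z hz
  have hz' : z ∈ Θ.target := by simpa using hz
  rw [Function.comp_apply, Function.comp_apply, Function.comp_apply, projectionInvolution_zero]
  change tangentChart Θ hΘ.mem_maximalAtlas (verticalLift n h (Θ.symm z)) = (P z, z - P z)
  rw [hΘ.tangentChart_verticalLift hh (Θ.map_target hz'), Θ.right_inv hz']

/-- The topology is induced because `(a, w) ↦ Θ.symm (a + w)` is a continuous local left inverse. -/
theorem isSmoothEmbedding_verticalLift (hh : IsHomogeneousStructure n h) :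
    Manifold.IsSmoothEmbedding (𝓡 n) (𝓡 n).tangent ∞ (verticalLift n h) := by
  refine ⟨hh.isImmersion_verticalLift, ?_, hh.verticalLift_injective⟩
  have hcont : Continuous (verticalLift n h) := hh.isImmersion_verticalLift.contMDiff.continuous
  rw [isInducing_iff_nhds]
  intro u
  refine le_antisymm hcont.continuousAt.le_comap fun s hs => ?_
  obtain ⟨P, Θ, hΘ, hu⟩ := hh.exists_homogeneousChart_of_point u
  let T := tangentChart Θ hΘ.mem_maximalAtlas
  -- Since `Θ.source` is a full preimage under `h₀`, a lift lying over it can only come from a point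
  -- of it.
  have hVT : ∀ x, verticalLift n h x ∈ T.source ↔ x ∈ Θ.source := fun x => by
    change (verticalLift n h x).1 ∈ Θ.source ↔ _
    rw [verticalLift_proj, ← hΘ.mem_source_iff]
  let g : TangentBundle (𝓡 n) F → F := fun v => Θ.symm ((T v).1 + (T v).2)
  have hadd : ∀ x ∈ Θ.source,
      (T (verticalLift n h x)).1 + (T (verticalLift n h x)).2 = Θ x := fun x hx => by
    rw [hΘ.tangentChart_verticalLift hh hx]
    simp
  have hg : ∀ x ∈ Θ.source, g (verticalLift n h x) = x := fun x hx => by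
    simp only [g]
    rw [hadd x hx, Θ.left_inv hx]
  have hgc : ContinuousAt g (verticalLift n h u) := by
    have h1 : ContinuousAt T (verticalLift n h u) := T.continuousAt ((hVT u).2 hu)
    have h2 : ContinuousAt (fun v => (T v).1 + (T v).2) (verticalLift n h u) :=
      (continuous_fst.continuousAt.comp h1).add (continuous_snd.continuousAt.comp h1)
    refine ContinuousAt.comp (g := Θ.symm) ?_ h2
    rw [hadd u hu]
    exact Θ.continuousAt_symm (Θ.map_source hu)
  refine ⟨g ⁻¹' s ∩ T.source, Filter.inter_mem (hgc.preimage_mem_nhds ?_)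
    (T.open_source.mem_nhds ((hVT u).2 hu)), fun x hx => ?_⟩
  · rwa [hg u hu]
  · have hxs : g (verticalLift n h x) ∈ s := hx.1
    rwa [hg x ((hVT x).1 hx.2)] at hxs

end IsHomogeneousStructure

end Homogeneous

/-! ### Uniqueness and existence of the vector bundle structure -/

section Homogeneous

theorem IsHomogeneousStructure.eq_of_verticalLift_snd_eq {n : ℕ} {F : Type*} [TopologicalSpace F]
    [ChartedSpace (EuclideanSpace ℝ (Fin n)) F] [IsManifold (𝓡 n) ∞ F] {h : ℝ≥0 → F → F}
    (hh : IsHomogeneousStructure n h) {u v : F} (h0 : h 0 u = h 0 v)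
    (huv : ((verticalLift n h u).2 : EuclideanSpace ℝ (Fin n)) = (verticalLift n h v).2) :
    u = v := by
  have h1 : (verticalLift n h u).1 = (verticalLift n h v).1 := by
    rw [verticalLift_proj, verticalLift_proj, h0]
  exact hh.verticalLift_injective (tangentBundle_mk_congr h1 huv)

namespace VectorBundleStructure

variable {n : ℕ} {F : Type*} [TopologicalSpace F] [ChartedSpace (EuclideanSpace ℝ (Fin n)) F]
  {h : ℝ≥0 → F → F} (S : VectorBundleStructure n F)

theorem homothety_coe (t : ℝ) {b : S.base} (u : S.Fibre b) :
    S.homothety t u = ((t • u : S.Fibre b) : F) := by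
  obtain ⟨x, rfl⟩ := u
  rfl

theorem proj_coe (b : S.base) : S.proj b = b := by
  have h1 := (0 : S.Fibre b).2
  rwa [S.coe_zero] at h1

variable {S}

/-- The homothety by `0` sends `x` to the zero vector of its fibre, which is the base point. -/
theorem coe_proj_eq (hS : ∀ (t : ℝ≥0) (x : F), S.homothety t x = h t x) (x : F) :
    (S.proj x : F) = h 0 x := by
  have h1 : S.homothety 0 x = h 0 x := by simpa using hS 0 x
  rw [← h1]
  change _ = (((0 : ℝ) • (⟨x, rfl⟩ : S.Fibre (S.proj x)) : S.Fibre (S.proj x)) : F)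
  rw [zero_smul, S.coe_zero]

theorem base_eq_range (hS : ∀ (t : ℝ≥0) (x : F), S.homothety t x = h t x) :
    S.base = range (h 0) := by
  ext b
  constructor
  · intro hb
    exact ⟨b, by rw [← coe_proj_eq hS, S.proj_coe ⟨b, hb⟩]⟩
  · rintro ⟨x, rfl⟩
    rw [← coe_proj_eq hS]
    exact (S.proj x).2

/-- In a bundle chart the orbit of `u` is `t ↦ (x, t y)` with `y` linear in `u`, so its velocity is
the derivative of `Φ.symm` applied to `(0, y)`. -/
theorem exists_linearMap_verticalLift [IsManifold (𝓡 n) ∞ F]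
    (hS : ∀ (t : ℝ≥0) (x : F), S.homothety t x = h t x) (b : S.base) :
    ∃ L : S.Fibre b →ₗ[ℝ] TangentSpace (𝓡 n) (b : F),
      ∀ u : S.Fibre b, verticalLift n h (u : F) = ⟨(b : F), L u⟩ := by
  obtain ⟨m, k, W, Φ, hb, hΦ, -, hsrc, hfst, hlin⟩ := S.locallyTrivial b
  have hy := hlin b hb
  let A : EuclideanSpace ℝ (Fin m) × EuclideanSpace ℝ (Fin k) →L[ℝ] EuclideanSpace ℝ (Fin n) :=
    mfderiv 𝓘(ℝ, EuclideanSpace ℝ (Fin m) × EuclideanSpace ℝ (Fin k)) (𝓡 n) Φ.symm (Φ b)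
  refine ⟨((A.comp (.inr ℝ _ _) : _ →L[ℝ] EuclideanSpace ℝ (Fin n)) :
    _ →ₗ[ℝ] EuclideanSpace ℝ (Fin n)).comp (hy.mk' _), fun u => ?_⟩
  have hmem : ∀ v : S.Fibre b, (v : F) ∈ Φ.source := fun v => by
    rw [hsrc, v.2]
    exact hb
  have hΦv : ∀ v : S.Fibre b, (Φ v).1 = (Φ b).1 := fun v => by
    rw [hfst v (hmem v) b hb, v.2, S.proj_coe]
  have hb2 : (Φ b).2 = 0 := by
    have := hy.map_zero
    rwa [S.coe_zero] at this
  have hc : HasDerivWithinAt (fun t : ℝ => ((Φ b).1, t • (Φ u).2))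
      ((0 : EuclideanSpace ℝ (Fin m)), (Φ u).2) (Ici 0) 0 := by
    have h1 : HasDerivAt (fun t : ℝ => t • (Φ u).2) (Φ u).2 0 := by
      simpa using (hasDerivAt_id (0 : ℝ)).smul_const (Φ u).2
    exact ((hasDerivAt_const (0 : ℝ) (Φ b).1).prodMk h1).hasDerivWithinAt
  have hd : MDifferentiableAt 𝓘(ℝ, EuclideanSpace ℝ (Fin m) × EuclideanSpace ℝ (Fin k)) (𝓡 n)
      Φ.symm (Φ b) :=
    (hΦ.contMDiffOn_symm.contMDiffAt
      (Φ.open_target.mem_nhds (Φ.map_source hb))).mdifferentiableAt (by simp)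
  rw [verticalLift_eq (z := Φ b) (f := Φ.symm) (Prod.ext rfl (by simp [hb2])) hc hd ?_]
  · exact tangentBundle_mk_congr (Φ.left_inv hb) rfl
  · filter_upwards [self_mem_nhdsWithin] with t ht
    rw [← hS, Real.coe_toNNReal _ ht, homothety_coe, Φ.eq_symm_apply (hmem _)]
    · exact Prod.ext (hΦv _) (hy.map_smul t u)
    · have h1 := Φ.map_source (hmem (t • u))
      have h2 : Φ (t • u : S.Fibre b) = ((Φ b).1, t • (Φ u).2) :=
        Prod.ext (hΦv _) (hy.map_smul t u)
      rwa [h2] at h1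

theorem verticalLift_add [IsManifold (𝓡 n) ∞ F]
    (hS : ∀ (t : ℝ≥0) (x : F), S.homothety t x = h t x) {b : S.base} (u v : S.Fibre b) :
    ((verticalLift n h (u + v : S.Fibre b)).2 : EuclideanSpace ℝ (Fin n)) =
      (show EuclideanSpace ℝ (Fin n) from (verticalLift n h u).2) +
        (show EuclideanSpace ℝ (Fin n) from (verticalLift n h v).2) := by
  obtain ⟨L, hL⟩ := exists_linearMap_verticalLift hS b
  rw [hL, hL, hL]
  exact map_add L u v

theorem verticalLift_smul [IsManifold (𝓡 n) ∞ F]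
    (hS : ∀ (t : ℝ≥0) (x : F), S.homothety t x = h t x) {b : S.base} (t : ℝ) (u : S.Fibre b) :
    ((verticalLift n h (t • u : S.Fibre b)).2 : EuclideanSpace ℝ (Fin n)) =
      t • ((verticalLift n h u).2 : EuclideanSpace ℝ (Fin n)) := by
  obtain ⟨L, hL⟩ := exists_linearMap_verticalLift hS b
  rw [hL, hL]
  exact map_smul L t u

/-- Base and projection are given by `h 0`. On a fibre the vertical lift depends only on `h`, is
injective, and is linear for both structures, so sums and all real multiples agree, including the
negative ones that `h` does not prescribe. -/
theorem eq_of_homothety [IsManifold (𝓡 n) ∞ F] (hh : IsHomogeneousStructure n h)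
    {S S' : VectorBundleStructure n F} (hS : ∀ (t : ℝ≥0) (x : F), S.homothety t x = h t x)
    (hS' : ∀ (t : ℝ≥0) (x : F), S'.homothety t x = h t x) : S = S' := by
  have hbase : S.base = S'.base := (base_eq_range hS).trans (base_eq_range hS').symm
  have hproj : ∀ x, (S.proj x : F) = S'.proj x := fun x =>
    (coe_proj_eq hS x).trans (coe_proj_eq hS' x).symm
  -- These consequences are recorded while `hS` and `hS'` are available; the structures are then
  -- taken apart and identified field by field.
  have hadd := fun b (u v : S.Fibre b) => verticalLift_add hS u v
  have hadd' := fun b (u v : S'.Fibre b) => verticalLift_add hS' u v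
  have hsmul := fun b (t : ℝ) (u : S.Fibre b) => verticalLift_smul hS t u
  have hsmul' := fun b (t : ℝ) (u : S'.Fibre b) => verticalLift_smul hS' t u
  have hh0 : ∀ {b : S.base} (u v : S.Fibre b), h 0 u = h 0 v := fun u v => by
    rw [← coe_proj_eq hS, ← coe_proj_eq hS, u.2, v.2]
  clear hS hS'
  obtain ⟨base, proj, _, _⟩ := S
  obtain ⟨base', proj', _, _⟩ := S'
  dsimp only at hbase hproj
  subst hbase
  obtain rfl : proj = proj' := funext fun x => Subtype.ext (hproj x)
  rename_i G₁ M₁ _ _ G₂ M₂ _ _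
  obtain rfl : G₁ = G₂ := by
    funext b
    apply AddCommGroup.ext
    funext u v
    exact Subtype.ext (hh.eq_of_verticalLift_snd_eq (hh0 _ _)
      ((hadd b u v).trans (hadd' b u v).symm))
  obtain rfl : M₁ = M₂ := by
    funext b
    refine Module.ext' _ _ fun t u => ?_
    exact Subtype.ext (hh.eq_of_verticalLift_snd_eq (hh0 _ _)
      ((hsmul b t u).trans (hsmul' b t u).symm))
  rfl

end VectorBundleStructure

variable {n : ℕ} {F : Type*} [TopologicalSpace F]
  [ChartedSpace (EuclideanSpace ℝ (Fin n)) F] [IsManifold (𝓡 n) ∞ F] {h : ℝ≥0 → F → F}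

namespace IsHomogeneousStructure

/-- Homogeneity of degree one, now independent of charts: it makes `h t` the multiplication by `t`
once the fibres carry the linear structure of the vertical vectors. -/
theorem verticalLift_act_snd (hh : IsHomogeneousStructure n h) (t : ℝ≥0) (u : F) :
    ((verticalLift n h (h t u)).2 : EuclideanSpace ℝ (Fin n)) =
      (t : ℝ) • ((verticalLift n h u).2 : EuclideanSpace ℝ (Fin n)) := by
  let φ := chartAt (EuclideanSpace ℝ (Fin n)) (h 0 u)
  have hφ : φ ∈ IsManifold.maximalAtlas (𝓡 n) ∞ F := IsManifold.chart_mem_maximalAtlas _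
  have hu : h 0 u ∈ φ.source := mem_chart_source _ _
  have hu' : h 0 (h t u) ∈ φ.source := by rwa [hh.zero_act]
  have h1 := hh.verticalLift_eq_chart hφ hu'
  rw [hh.zero_act, hh.chartVerticalLift_act hφ hu] at h1
  rw [h1, hh.verticalLift_eq_chart hφ hu]
  exact map_smul (show EuclideanSpace ℝ (Fin n) →L[ℝ] EuclideanSpace ℝ (Fin n) from
    mfderiv (𝓡 n) (𝓡 n) φ.symm (φ (h 0 u))) (t : ℝ) (chartVerticalLift φ h u)

theorem verticalLift_snd_of_mem (hh : IsHomogeneousStructure n h) {b : F} (hb : b ∈ range (h 0)) :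
    ((verticalLift n h b).2 : EuclideanSpace ℝ (Fin n)) = 0 := by
  have h1 := hh.verticalLift_act_snd 0 b
  rw [hh.act_of_mem hb] at h1
  simpa using h1

/-- The vertical vectors at `b`, as a subspace of the model space. -/
noncomputable def verticalSpace (n : ℕ) {F : Type*} [TopologicalSpace F]
    [ChartedSpace (EuclideanSpace ℝ (Fin n)) F] (h : ℝ≥0 → F → F) (b : F) :
    Submodule ℝ (EuclideanSpace ℝ (Fin n)) :=
  LinearMap.ker (show EuclideanSpace ℝ (Fin n) →L[ℝ] EuclideanSpace ℝ (Fin n) from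
    mfderiv (𝓡 n) (𝓡 n) (h 0) b).toLinearMap

theorem verticalLift_snd_mem (hh : IsHomogeneousStructure n h) (u : F) :
    ((verticalLift n h u).2 : EuclideanSpace ℝ (Fin n)) ∈ verticalSpace n h (h 0 u) := by
  have h1 : verticalLift n h u ∈ verticalVectors n h := by
    rw [← hh.range_verticalLift]
    exact mem_range_self u
  have h2 := h1.2
  rw [verticalLift_proj] at h2
  exact h2

/-- The fibre of `h₀` over `b` is identified with the space of vertical vectors at `b`. -/
noncomputable def fibreEquiv (hh : IsHomogeneousStructure n h) (b : range (h 0)) :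
    {x : F // (⟨h 0 x, mem_range_self x⟩ : range (h 0)) = b} ≃ verticalSpace n h (b : F) :=
  Equiv.ofBijective
    (fun u => ⟨(verticalLift n h (u : F)).2, by
      have h1 := hh.verticalLift_snd_mem (u : F)
      rwa [show h 0 (u : F) = b from congrArg Subtype.val u.2] at h1⟩) (by
    constructor
    · intro u u' huu
      have h0 : h 0 (u : F) = h 0 (u' : F) := congrArg Subtype.val (u.2.trans u'.2.symm)
      exact Subtype.ext (hh.eq_of_verticalLift_snd_eq h0 (congrArg Subtype.val huu))
    · rintro ⟨v, hv⟩
      have h1 : (⟨(b : F), v⟩ : TangentBundle (𝓡 n) F) ∈ range (verticalLift n h) := by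
        rw [hh.range_verticalLift]
        exact ⟨b.2, hv⟩
      obtain ⟨u, hu⟩ := h1
      have h2 : h 0 u = b := by
        rw [← verticalLift_proj (n := n) (h := h), hu]
      refine ⟨⟨u, Subtype.ext h2⟩, Subtype.ext ?_⟩
      change ((verticalLift n h u).2 : EuclideanSpace ℝ (Fin n)) = v
      rw [hu])

/-- The vector bundle structure whose homotheties are given by `h`. -/
noncomputable def vectorBundleStructure (hh : IsHomogeneousStructure n h) :
    VectorBundleStructure n F where
  base := range (h 0)
  proj x := ⟨h 0 x, mem_range_self x⟩
  fibreAddCommGroup b := (hh.fibreEquiv b).addCommGroup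
  fibreModule b := (hh.fibreEquiv b).module ℝ
  coe_zero b := by
    have h1 : (hh.fibreEquiv b).symm 0 = ⟨b, Subtype.ext (hh.act_of_mem b.2 0)⟩ := by
      rw [Equiv.symm_apply_eq]
      exact Subtype.ext (hh.verticalLift_snd_of_mem b.2).symm
    exact congrArg Subtype.val h1
  locallyTrivial b := by
    obtain ⟨m, k, W, Φ, L, hb, hΦ, hW, hsrc, hzero, hL⟩ := hh.exists_productChart b.2
    refine ⟨m, k, W, Φ, hb, hΦ, hW, hsrc, fun x hx y hy => ?_, fun c hc => ?_⟩
    · rw [Subtype.mk.injEq, ← Φ.injOn.eq_iff ((hsrc x).1 hx) ((hsrc y).1 hy), hzero x hx,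
        hzero y hy]
      simp
    -- The fibre coordinate is a fixed linear function of the vertical lift, which is linear by the
    -- choice of the operations.
    · have h1 : ∀ u : {x : F // (⟨h 0 x, mem_range_self x⟩ : range (h 0)) = c},
          (Φ u).2 = L c (hh.fibreEquiv c u) := fun u => by
        have h2 : h 0 (u : F) = c := congrArg Subtype.val u.2
        rw [hL u ((hsrc u).2 (by rwa [h2])), h2]
        rfl
      let _ := (hh.fibreEquiv c).addCommGroup
      let _ : Module ℝ {x : F // (⟨h 0 x, mem_range_self x⟩ : range (h 0)) = c} :=
        (hh.fibreEquiv c).module ℝ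
      constructor
      · intro u v
        rw [h1, h1, h1, ← map_add, ← Submodule.coe_add]
        exact congrArg (fun w : verticalSpace n h (c : F) => L c w)
          ((hh.fibreEquiv c).apply_symm_apply (hh.fibreEquiv c u + hh.fibreEquiv c v))
      · intro t u
        rw [h1, h1, ← map_smul, ← Submodule.coe_smul]
        exact congrArg (fun w : verticalSpace n h (c : F) => L c w)
          ((hh.fibreEquiv c).apply_symm_apply (t • hh.fibreEquiv c u))

theorem homothety_vectorBundleStructure (hh : IsHomogeneousStructure n h) (t : ℝ≥0) (x : F) :
    hh.vectorBundleStructure.homothety t x = h t x := by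
  let b : range (h 0) := ⟨h 0 x, mem_range_self x⟩
  have h1 : (hh.fibreEquiv b).symm ((t : ℝ) • hh.fibreEquiv b ⟨x, rfl⟩) =
      ⟨h t x, Subtype.ext (hh.zero_act t x)⟩ := by
    rw [Equiv.symm_apply_eq]
    exact Subtype.ext (hh.verticalLift_act_snd t x).symm
  exact congrArg Subtype.val h1

end IsHomogeneousStructure

end Homogeneous

theorem theorem2p1 (n : ℕ) (F : Type*) [TopologicalSpace F] [T2Space F] [ParacompactSpace F]
    [ChartedSpace (EuclideanSpace ℝ (Fin n)) F] [IsManifold (𝓡 n) ∞ F]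
    (h : ℝ≥0 → F → F) (hh : IsHomogeneousStructure n h) :
    -- the unique vector bundle structure with homotheties `h`
    (∃! S : VectorBundleStructure n F, ∀ (t : ℝ≥0) (x : F), S.homothety t x = h t x) ∧
    -- `h₀(F)` is a submanifold, and the vertical lift is a diffeomorphism of `F` onto a vector
    -- subbundle of `TF` over `h₀(F)`, namely the one of the vertical vectors
    IsEmbeddedSubmanifold (𝓡 n) (range (h 0)) ∧
    IsTangentSubbundleOver n (range (h 0)) (verticalVectors n h) ∧
    Manifold.IsSmoothEmbedding (𝓡 n) (𝓡 n).tangent ∞ (verticalLift n h) ∧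
    range (verticalLift n h) = verticalVectors n h ∧
    -- the bundle projection is `h₀` onto the base `h₀(F)`, and the vertical lift is linear on fibres
    ∀ S : VectorBundleStructure n F, (∀ (t : ℝ≥0) (x : F), S.homothety t x = h t x) →
      S.base = range (h 0) ∧ (∀ x : F, (S.proj x : F) = h 0 x) ∧
      ∀ b : S.base, ∃ L : S.Fibre b →ₗ[ℝ] TangentSpace (𝓡 n) (b : F),
        ∀ u : S.Fibre b, verticalLift n h (u : F) = ⟨(b : F), L u⟩ := by
  exact ⟨⟨hh.vectorBundleStructure, hh.homothety_vectorBundleStructure,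
      fun S hS => VectorBundleStructure.eq_of_homothety hh hS hh.homothety_vectorBundleStructure⟩,
    hh.isEmbeddedSubmanifold, hh.isTangentSubbundleOver, hh.isSmoothEmbedding_verticalLift,
    hh.range_verticalLift, fun S hS => ⟨VectorBundleStructure.base_eq_range hS,
      VectorBundleStructure.coe_proj_eq hS,
      VectorBundleStructure.exists_linearMap_verticalLift hS⟩⟩
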